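/- Let $p$ be an odd prime and let $H$ be a group isomorphic to $\mathbb{Z}_p^4$, written additively. For $T\subseteq H$ let $\underline{T}=\sum_{h\in T}h\in\mathbb{Q}H$, and let $\mathrm{Cay}(H,T)$ be the digraph on $H$ with arcs $(x,s+x)$, $x\in H$, $s\in T$. An S-ring over $H$ is a subalgebra $\mathcal{A}\subseteq\mathbb{Q}H$ spanned by the elements $\underline{T}$, $T\in\mathrm{Bsets}(\mathcal{A})$, where $\mathrm{Bsets}(\mathcal{A})$ is a partition of $H$ (into the basic sets of $\mathcal A$) that contains $\{0\}$ and contains $-T$ for each of its classes $T$. A subgroup $K\le H$ is an $\mathcal{A}$-subgroup if $\underline{K}\in\mathcal{A}$, and $\mathrm{rad}(T)=\{h\in H: h+T=T+h=T\}$. Let $H_R\le\mathrm{Sym}(H)$ be the group of all translations $x\mapsto x+h$, and let $\mathrm{Aut}(\mathcal{A})=\bigcap_{T\in\mathrm{Bsets}(\mathcal{A})}\mathrm{Aut}(\mathrm{Cay}(H,T))$. The S-ring $\mathcal{A}$ is - a $p$-S-ring if every basic set has $p$-power size; - Schurian if there is $K$ with $H_R\le K\le\mathrm{Sym}(H)$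 such that $\mathcal{A}$ is the span of the elements $\underline{T}$, $T$ an orbit on $H$ of the stabilizer $K_0$; - decomposable if there are $\mathcal{A}$-subgroups $F\le E$ of $H$ with $E\ne H$ and $F\ne\{0\}$ such that $F\le\mathrm{rad}(T)$ for every basic set $T\subseteq H\setminus E$; and indecomposable otherwise. Two permutation groups on $H$ are 2-equivalent if they have the same orbits on $H\times H$. Let $\mathcal{A}$ be an indecomposable $p$-S-ring over $H$. Then $H_R$ is a normal subgroup of $\mathrm{Aut}(\mathcal{A})$ and $|\mathrm{Aut}(\mathcal{A})|\le p^6$. If, moreover, $\mathcal{A}$ is Schurian, then $\mathrm{Aut}(\mathcal{A})$ is the only group $X$ with $H_R\le X\le\mathrm{Sym}(H)$ that is 2-equivalent to $\mathrm{Aut}(\mathcal{A})$. -/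

import Mathlib

namespace SchurRing

open scoped Classical in
/-- The simple quantity of a subset `T` of a finite (additively written) group `H`: the sum of the
elements of `T` in the group algebra `ℚH`. -/
noncomputable def simpleQuantity {H : Type*} [Fintype H] (T : Set H) : AddMonoidAlgebra ℚ H :=
  ∑ h : H, if h ∈ T then AddMonoidAlgebra.single h 1 else 0

/-- The arc relation of the Cayley digraph `Cay(H, T)`: its arcs are the pairs `(x, s + x)` with
`x ∈ H` and `s ∈ T`. -/
def CayleyAdj {H : Type*} [AddGroup H] (T : Set H) (x y : H) : Prop :=
  ∃ s ∈ T, y = s + x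

/-- The automorphism group of the digraph on `Ω` with arc relation `r`. -/
def digraphAut {Ω : Type*} (r : Ω → Ω → Prop) : Subgroup (Equiv.Perm Ω) where
  carrier := {g | ∀ x y, r (g x) (g y) ↔ r x y}
  mul_mem' := by
    intro a b ha hb x y
    simp only [Set.mem_ofPred_eq, Equiv.Perm.mul_apply] at *
    rw [ha, hb]
  one_mem' := by
    intro x y
    simp
  inv_mem' := by
    intro a ha x y
    simp only [Set.mem_ofPred_eq] at ha
    rw [← ha]
    simp

/-- The group `H_R` of all right translations `x ↦ x + h`, `h ∈ H`. -/
def rightTranslations (H : Type*) [AddGroup H] : Subgroup (Equiv.Perm H) where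
  carrier := Set.range (fun h : H => Equiv.addRight h)
  mul_mem' := by
    rintro _ _ ⟨a, rfl⟩ ⟨b, rfl⟩
    exact ⟨b + a, by ext x; simp [add_assoc]⟩
  one_mem' := ⟨0, by ext x; simp⟩
  inv_mem' := by
    rintro _ ⟨a, rfl⟩
    exact ⟨-a, by ext x; simp⟩

/-- The set `Orb(G, Ω²)` of all orbits on ordered pairs of a permutation group `G` on `Ω`. -/
def pairOrbits {Ω : Type*} (G : Subgroup (Equiv.Perm Ω)) : Set (Set (Ω × Ω)) :=
  Set.range (fun w : Ω × Ω => MulAction.orbit G w)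

/-- Two permutation groups on `Ω` are 2-equivalent if they have the same orbits on `Ω²`. -/
def TwoEquivalent {Ω : Type*} (G K : Subgroup (Equiv.Perm Ω)) : Prop :=
  pairOrbits G = pairOrbits K

/-- The orbits on `H` of the stabilizer in `K` of the identity element `0`. -/
def stabilizerOrbits {H : Type*} [AddGroup H] (K : Subgroup (Equiv.Perm H)) : Set (Set H) :=
  Set.range (fun h : H => MulAction.orbit (MulAction.stabilizer K (0 : H)) h)

/-- The transitivity module `V(H, K_0)`: the span in `ℚH` of the simple quantities of the orbits
of the stabilizer `K_0`. -/
noncomputable def transitivityModule {H : Type*} [AddGroup H] [Fintype H]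
    (K : Subgroup (Equiv.Perm H)) : Submodule ℚ (AddMonoidAlgebra ℚ H) :=
  Submodule.span ℚ (simpleQuantity '' stabilizerOrbits K)

/-- The radical of a subset `S` of `H`: the subgroup of all `h` with `h + S = S + h = S`. -/
def radical {H : Type*} [AddGroup H] (S : Set H) : AddSubgroup H where
  carrier := {h | (fun s => h + s) '' S = S ∧ (fun s => s + h) '' S = S}
  add_mem' := by
    rintro a b ⟨ha, ha'⟩ ⟨hb, hb'⟩
    refine ⟨?_, ?_⟩
    · conv_rhs => rw [← ha, ← hb]
      simp only [Set.image_image, add_assoc]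
    · conv_rhs => rw [← hb', ← ha']
      simp only [Set.image_image, add_assoc]
  zero_mem' := by simp
  neg_mem' := by
    rintro a ⟨ha, ha'⟩
    refine ⟨?_, ?_⟩
    · conv_lhs => rw [← ha]
      simp only [Set.image_image, neg_add_cancel_left, Set.image_id']
    · conv_lhs => rw [← ha']
      simp only [Set.image_image, add_neg_cancel_right, Set.image_id']

/-- A Schur ring (S-ring) over a finite group `H`, written additively: a subalgebra of the rational
group algebra of `H` that is spanned by the simple quantities of the classes of a partition of `H`
which contains `{0}` and is closed under taking inverses. The classes are the basic sets (they are
determined by the subalgebra). -/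
structure SRing (H : Type*) [AddGroup H] [Fintype H] where
  /-- the underlying subalgebra of the group algebra -/
  algebra : Subalgebra ℚ (AddMonoidAlgebra ℚ H)
  /-- the set of all basic sets -/
  basicSets : Set (Set H)
  isPartition : Setoid.IsPartition basicSets
  zero_mem : {0} ∈ basicSets
  neg_mem : ∀ T ∈ basicSets, (fun h : H => -h) '' T ∈ basicSets
  span_eq : Subalgebra.toSubmodule algebra = Submodule.span ℚ (simpleQuantity '' basicSets)

namespace SRing

variable {H : Type*} [AddGroup H] [Fintype H]

/-- `K ≤ H` is an `A`-subgroup if its simple quantity belongs to `A`. -/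
def IsSub (A : SRing H) (K : AddSubgroup H) : Prop :=
  simpleQuantity (K : Set H) ∈ A.algebra

/-- `A` is an `E/F`-wreath product (generalized wreath product). -/
def IsWreath (A : SRing H) (E F : AddSubgroup H) : Prop :=
  A.IsSub E ∧ A.IsSub F ∧ F ≤ E ∧ F.Normal ∧
    ∀ T ∈ A.basicSets, T ⊆ (E : Set H)ᶜ → F ≤ radical T

/-- `A` is decomposable if it is an `E/F`-wreath product with `E ≠ H` and `F ≠ {0}`. -/
def Decomposable (A : SRing H) : Prop :=
  ∃ E F : AddSubgroup H, A.IsWreath E F ∧ E ≠ ⊤ ∧ F ≠ ⊥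

/-- `A` is indecomposable if it is not decomposable. -/
def Indecomposable (A : SRing H) : Prop :=
  ¬ A.Decomposable

/-- `A` is Schurian if `A = V(H, K_0)` for some permutation group `K` on `H` containing `H_R`. -/
def Schurian (A : SRing H) : Prop :=
  ∃ K : Subgroup (Equiv.Perm H), rightTranslations H ≤ K ∧
    Subalgebra.toSubmodule A.algebra = transitivityModule K

/-- `A` is a `p`-S-ring if `H` is a `p`-group and all basic sets have `p`-power size. -/
def IsPSRing (p : ℕ) (A : SRing H) : Prop :=
  (∃ n : ℕ, Nat.card H = p ^ n) ∧ ∀ T ∈ A.basicSets, ∃ k : ℕ, T.ncard = p ^ k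

/-- The automorphism group of `A`: all permutations of `H` that are automorphisms of each of the
Cayley digraphs `Cay(H, T)`, `T` a basic set. -/
def aut (A : SRing H) : Subgroup (Equiv.Perm H) :=
  ⨅ T ∈ A.basicSets, digraphAut (CayleyAdj T)

/-- `A` is minimal with respect to 2-equivalence: the only permutation group on `H` that contains
`H_R` and is 2-equivalent to `Aut(A)` is `Aut(A)` itself. -/
def TwoEquivMinimal (A : SRing H) : Prop :=
  {X : Subgroup (Equiv.Perm H) | rightTranslations H ≤ X ∧ TwoEquivalent X A.aut} = {A.aut}

end SRing

end SchurRing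

/-!
Write `G` for the automorphism group of the S-ring. Everything follows from the existence of a base
point, an `x` in `H` such that only the identity of `G` fixes both `0` and `x`. Then `G` is
determined by its orbits on pairs, and `|G| ≤ |H| |T|` where `T` is the basic set of `x`. The
dichotomy `PSchurPartition.exists_base_or` says that there is a base point in a basic set of size at
most `p`, or that all points outside some `A`-subgroup `E` of index `p` are base points in basic
sets of size at most `p²`. This gives `|G| ≤ p⁶`. Moreover `G` is a `p`-group. In the first case the
translations have index at most `p` in `G`, so they are normal. In the second case the index is at
most `p²`; if the group of translations were not normal, it would have a conjugate inside its
normalizer, and this yields an automorphism `g` which is not a translation and commutes with `p³`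
translations (`normal_or_exists_commute`). After correction by a translation, `g` fixes all points
of `E` or a base point outside `E`, a contradiction.

The S-ring is used only through its partition into basic sets, the constancy of the structure
constants, and Schur's theorem that multiplication by an integer prime to `p` permutes the basic
sets. All arguments about automorphisms `g` are about the differences `g x - g y`, which lie in the
basic set of `x - y`. Three tools carry the proof of the dichotomy.

* If `g` is trivial modulo `L` on a coset of an `A`-subgroup `K` of index `p` in `M`, it moves the
  points of the other cosets by elements that stabilize all basic sets in `M \ K` modulo `L`
  (`IsAut.sub_mem_outerRad`). For `M = H` and `L = 0` indecomposability says that there are no such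
  elements, so that `g = 1`.
* If `L` is a subgroup of order `p` of the thin radical, the basic sets meeting every coset of `L` at
  most once generate `H` by indecomposability (`Indecomposable.closure_isSection`), and on these the
  behaviour of `g` is rigid.
* A function whose increments along `t₁`, `t₂` and `t₁ + t₂` lie in three independent subgroups is
  zero if it vanishes at `0` and `t₁` (`eq_zero_of_three_directions`).

The proof of the dichotomy distinguishes the order of the thin radical, the group of all `t` such
that `{t}` is a basic set; it is nontrivial because of `p`-power sizes. The hardest case is that of a
thin radical `L` of order `p` such that the basic sets outside `E` have `p²` elements and meet each
coset of `L` in a coset of `E` once, while the basic sets in `E \ L` are unions of cosets of `L`.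
There a count of differences (`card_differences_le`) shows that the subgroups in which the
displacement of `g` may vary are independent, and the third tool applies.
-/

/-! ### Partitions into basic sets, quotients and the thin radical -/

namespace SchurRing

/-- The combinatorial content of a `p`-S-ring over an elementary abelian `p`-group: the partition
into basic sets is encoded by the relation `rel` of lying in the same basic set. Closure under
multipliers, a theorem for S-rings over abelian groups, is made part of the structure; negation is
the multiplier `-1`. -/
structure PSchurPartition (p : ℕ) (H : Type*) [AddCommGroup H] where
  /-- `x` and `y` lie in the same basic set -/
  rel : H → H → Prop
  refl : ∀ x, rel x x
  symm : ∀ {x y}, rel x y → rel y x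
  trans : ∀ {x y z}, rel x y → rel y z → rel x z
  eq_zero : ∀ {x}, rel x 0 → x = 0
  /-- Schur's theorem on multipliers -/
  zsmul : ∀ (m : ℤ) {x y}, rel x y → rel (m • x) (m • y)
  /-- the product of two unions of basic sets has constant coefficients on the basic sets -/
  count : ∀ {S S' : Set H}, (∀ x y, rel x y → x ∈ S → y ∈ S) →
    (∀ x y, rel x y → x ∈ S' → y ∈ S') → ∀ {x y}, rel x y →
      {u | u ∈ S ∧ x - u ∈ S'}.ncard = {u | u ∈ S ∧ y - u ∈ S'}.ncard
  card_class : ∀ x, ∃ k, {y | rel y x}.ncard = p ^ k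
  nsmul_eq_zero : ∀ x : H, p • x = 0

namespace PSchurPartition

variable {p : ℕ} {H : Type*} [AddCommGroup H] (P : PSchurPartition p H)

theorem neg {x y : H} (h : P.rel x y) : P.rel (-x) (-y) := by
  simpa using P.zsmul (-1) h

/-- `K` is an `A`-subgroup: a union of basic sets. -/
def Sat (K : AddSubgroup H) : Prop := ∀ x y, P.rel x y → x ∈ K → y ∈ K

/-- If `z` is a sum of elements of the basic sets of `u` and `v`, then so is every element of the
basic set of `z`. -/
theorem split [Finite H] {z z' u v : H} (h : P.rel z z') (hz : z = u + v) :
    ∃ u' v', P.rel u' u ∧ P.rel v' v ∧ z' = u' + v' := by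
  have key := P.count (S := {y | P.rel y u}) (S' := {y | P.rel y v})
    (fun x y hxy hx => P.trans (P.symm hxy) hx) (fun x y hxy hx => P.trans (P.symm hxy) hx) h
  have hpos : 0 < {a | a ∈ {y | P.rel y u} ∧ z - a ∈ {y | P.rel y v}}.ncard := by
    rw [Set.ncard_pos]
    refine ⟨u, P.refl u, ?_⟩
    have : z - u = v := by rw [hz]; abel
    simpa [this] using P.refl v
  rw [key, Set.ncard_pos] at hpos
  obtain ⟨a, ha, hb⟩ := hpos
  exact ⟨a, z' - a, ha, hb, by abel⟩

theorem sat_bot : P.Sat ⊥ := by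
  intro x y h hx
  rw [AddSubgroup.mem_bot] at *
  subst hx
  exact P.eq_zero (P.symm h)

theorem sat_top : P.Sat ⊤ := fun _ _ _ _ => trivial

theorem exists_inv (P : PSchurPartition p H) (hp : p.Prime) {m : ℤ} (hm : ¬ (p : ℤ) ∣ m) :
    ∃ m' : ℤ, ∀ x : H, m' • m • x = x ∧ m • m' • x = x := by
  have hc : IsCoprime (p : ℤ) m := by
    rw [Int.isCoprime_iff_gcd_eq_one]
    exact (Int.isCoprime_iff_gcd_eq_one).1
      ((Nat.prime_iff_prime_int.1 hp).coprime_iff_not_dvd.2 hm)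
  obtain ⟨a, b, hab⟩ := hc
  have key : ∀ x : H, (b * m) • x = x := by
    intro x
    have h1 : (a * (p : ℤ)) • x = 0 := by
      rw [mul_smul, natCast_zsmul, P.nsmul_eq_zero, smul_zero]
    calc (b * m) • x = (a * (p : ℤ)) • x + (b * m) • x := by rw [h1, zero_add]
      _ = x := by rw [← add_smul, hab, one_smul]
  refine ⟨b, fun x => ⟨?_, ?_⟩⟩
  · rw [smul_smul, key]
  · rw [smul_smul, mul_comm, key]

theorem zsmul_eq_zero_of_dvd (P : PSchurPartition p H) {m : ℤ} (hm : (p : ℤ) ∣ m) (x : H) :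
    m • x = 0 := by
  obtain ⟨c, rfl⟩ := hm
  rw [mul_comm, mul_smul, natCast_zsmul, P.nsmul_eq_zero, smul_zero]

theorem card_subgroup [Finite H] (hp : p.Prime) {n : ℕ} (hH : Nat.card H = p ^ n)
    (K : AddSubgroup H) : ∃ i ≤ n, Nat.card K = p ^ i := by
  have : Nat.card K ∣ p ^ n := hH ▸ AddSubgroup.card_addSubgroup_dvd_card K
  exact (Nat.dvd_prime_pow hp).1 this

theorem eq_of_lt_of_le_of_card [Finite H] (hp : p.Prime) {K X M : AddSubgroup H} (hKX : K < X)
    (hXM : X ≤ M) (hc : Nat.card M = p * Nat.card K) : X = M := by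
  obtain ⟨a, ha⟩ := AddSubgroup.card_dvd_of_le hKX.le
  obtain ⟨b, hb⟩ := AddSubgroup.card_dvd_of_le hXM
  have hK : 0 < Nat.card K := Nat.card_pos
  have hab : a * b = p := by
    have : Nat.card K * (a * b) = Nat.card K * p := by
      rw [← mul_assoc, ← ha, ← hb, hc, mul_comm]
    exact Nat.eq_of_mul_eq_mul_left hK this
  rcases (Nat.dvd_prime hp).1 (Dvd.intro _ hab) with h1 | h1
  · exfalso
    subst h1
    have : K = X := AddSubgroup.eq_of_le_of_card_ge hKX.le (by omega)
    exact hKX.ne this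
  · apply AddSubgroup.eq_of_le_of_card_ge hXM
    rw [hc, ha, h1, mul_comm]

/-- A subgroup of index `p` and one more element span. -/
theorem exists_zsmul_sub_mem [Finite H] (hp : p.Prime) {K M : AddSubgroup H} (hKM : K ≤ M)
    (hc : Nat.card M = p * Nat.card K) {x t : H} (hx : x ∈ M) (hxK : x ∉ K) (ht : t ∈ M) :
    ∃ m : ℤ, t - m • x ∈ K := by
  have h : K ⊔ AddSubgroup.zmultiples x = M := by
    refine eq_of_lt_of_le_of_card hp (lt_of_le_of_ne le_sup_left ?_) (sup_le hKM ?_) hc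
    · intro h
      exact hxK (h ▸ AddSubgroup.mem_sup_right (AddSubgroup.mem_zmultiples x))
    · simpa using hx
  rw [← h, AddSubgroup.mem_sup] at ht
  obtain ⟨y, hy, z, hz, rfl⟩ := ht
  obtain ⟨m, rfl⟩ := AddSubgroup.mem_zmultiples_iff.1 hz
  exact ⟨m, by simpa using hy⟩

theorem exists_unit_zsmul_sub_mem [Finite H] (P : PSchurPartition p H) (hp : p.Prime)
    {K M : AddSubgroup H} (hKM : K ≤ M)
    (hc : Nat.card M = p * Nat.card K) {x t : H} (hx : x ∈ M) (hxK : x ∉ K) (ht : t ∈ M)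
    (htK : t ∉ K) :
    ∃ m m' : ℤ, (∀ x : H, m' • m • x = x ∧ m • m' • x = x) ∧ t - m • x ∈ K := by
  obtain ⟨m, hm⟩ := exists_zsmul_sub_mem hp hKM hc hx hxK ht
  have : ¬ (p : ℤ) ∣ m := by
    intro h
    rw [P.zsmul_eq_zero_of_dvd h, sub_zero] at hm
    exact htK hm
  obtain ⟨m', hm'⟩ := P.exists_inv hp this
  exact ⟨m, m', hm', hm⟩

/-- Equality of the images in `H ⧸ K` of the basic sets of `x` and `y`; equivalently, `x` and `y`
lie in the same basic set modulo `K`. -/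
def near (K : AddSubgroup H) (x y : H) : Prop := ∃ k ∈ K, P.rel (x + k) y

theorem near_of_rel (K : AddSubgroup H) {x y : H} (h : P.rel x y) : P.near K x y :=
  ⟨0, K.zero_mem, by simpa using h⟩

theorem near_add (K : AddSubgroup H) (x : H) {k : H} (hk : k ∈ K) : P.near K x (x + k) :=
  ⟨k, hk, P.refl _⟩

theorem near_zsmul (K : AddSubgroup H) (m : ℤ) {x y : H} (h : P.near K x y) :
    P.near K (m • x) (m • y) := by
  obtain ⟨k, hk, h⟩ := h
  refine ⟨m • k, K.zsmul_mem hk m, ?_⟩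
  rw [← smul_add]
  exact P.zsmul m h

theorem near_bot {x y : H} : P.near ⊥ x y ↔ P.rel x y := by
  constructor
  · rintro ⟨k, hk, h⟩
    rw [AddSubgroup.mem_bot] at hk
    simpa [hk] using h
  · exact P.near_of_rel ⊥

theorem diff_add_mem {K M : AddSubgroup H} (hKM : K ≤ M) :
    ∀ t ∈ (M : Set H) \ K, ∀ k ∈ K, t + k ∈ (M : Set H) \ K := by
  rintro t ⟨ht, ht'⟩ k hk
  exact ⟨M.add_mem ht (hKM hk), fun h => ht' ((K.add_mem_cancel_right hk).1 h)⟩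

section
variable [Finite H] {K : AddSubgroup H} (hK : P.Sat K)
include hK

theorem near_symm {x y : H} (h : P.near K x y) : P.near K y x := by
  obtain ⟨k, hk, h⟩ := h
  obtain ⟨x', k', hx', hk', rfl⟩ := P.split h rfl
  refine ⟨-k', K.neg_mem (hK _ _ (P.symm hk') hk), ?_⟩
  simpa using hx'

theorem near_trans {x y z : H} (h : P.near K x y) (h' : P.near K y z) : P.near K x z := by
  obtain ⟨k, hk, h⟩ := P.near_symm hK h
  obtain ⟨k', hk', h'⟩ := h'
  obtain ⟨y1, k1, hy1, hk1, e⟩ := P.split h' rfl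
  obtain ⟨y2, k2, hy2, hk2, e2⟩ := P.split h rfl
  refine P.near_symm hK ?_
  have h3 : P.rel y2 y1 := P.trans hy2 (P.symm hy1)
  -- `x - k2` and `z - k1` lie in the same basic set
  have hk1' : k1 ∈ K := hK _ _ (P.symm hk1) hk'
  have hk2' : k2 ∈ K := hK _ _ (P.symm hk2) hk
  have h4 : P.rel y2 (z + (-k1)) := by rw [e]; simpa using h3
  obtain ⟨z', k3, hz', hk3, e3⟩ := P.split (P.symm h4) rfl
  have hk3' : k3 ∈ K := hK _ _ (P.symm hk3) (K.neg_mem hk1')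
  have : P.near K x z := by
    refine ⟨-k2 - k3, K.sub_mem (K.neg_mem hk2') hk3', ?_⟩
    have : x + (-k2 - k3) = z' := by rw [e2, e3]; abel
    rw [this]; exact hz'
  exact P.near_symm hK this

end

/-- `g` maps every pair of points to a pair whose difference lies in the same basic set. For a
permutation this means that it is an automorphism of all the Cayley digraphs of basic sets. -/
def IsAut (g : H → H) : Prop := ∀ x y, P.rel (g x - g y) (x - y)

section
variable {P}

theorem IsAut.rel_self {g : H → H} (hg : P.IsAut g) (h0 : g 0 = 0) (x : H) : P.rel (g x) x := by
  simpa [h0] using hg x 0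

/-- Translating back an automorphism gives an automorphism that fixes `0`. -/
theorem IsAut.sub_const {g : H → H} (hg : P.IsAut g) : P.IsAut fun z => g z - g 0 := by
  intro x y
  simpa using hg x y

end

/-- The preimage in `H` of the thin radical of the quotient S-ring over `H ⧸ K`: the elements whose
basic set lies in a single coset of `K`. In particular `thinMod ⊥` is the thin radical, the group
of all `t` such that `{t}` is a basic set. -/
def thinMod [Finite H] (K : AddSubgroup H) : AddSubgroup H where
  carrier := {y | ∀ x, P.rel x y → x - y ∈ K}
  add_mem' := by
    intro a b ha hb x hx
    obtain ⟨a', b', ha', hb', rfl⟩ := P.split (P.symm hx) rfl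
    have : a' + b' - (a + b) = (a' - a) + (b' - b) := by abel
    rw [this]
    exact K.add_mem (ha _ ha') (hb _ hb')
  zero_mem' := by
    intro x hx
    rw [P.eq_zero hx]; simp
  neg_mem' := by
    intro a ha x hx
    have := ha (-x) (by simpa using P.neg hx)
    have e : x - -a = -(-x - a) := by abel
    rw [e]
    exact K.neg_mem this

theorem le_thinMod [Finite H] {K : AddSubgroup H} (hK : P.Sat K) : K ≤ P.thinMod K :=
  fun _ hy _ hx => K.sub_mem (hK _ _ (P.symm hx) hy) hy

theorem sat_of_le_thinMod [Finite H] {K X : AddSubgroup H} (h1 : K ≤ X)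
    (h2 : X ≤ P.thinMod K) : P.Sat X := by
  intro x y hxy hx
  have := h1 (h2 hx y (P.symm hxy))
  simpa using X.add_mem this hx

/-- The cosets of `K` that meet a basic set all meet it in the same number of points, so `T + K` has
`p`-power size for every basic set `T`. -/
theorem card_near [Finite H] (hp : p.Prime) {n : ℕ} (hH : Nat.card H = p ^ n)
    {K : AddSubgroup H} (hK : P.Sat K) (y : H) :
    ∃ e, {x | P.near K x y}.ncard = p ^ e := by
  classical
  have := Fintype.ofFinite H
  obtain ⟨a, ha⟩ := P.card_class y
  obtain ⟨i, -, hi⟩ := card_subgroup hp hH K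
  set T : Set H := {x | P.rel x y} with hT
  set c := {u | u ∈ T ∧ y - u ∈ (K : Set H)}.ncard with hc
  have hconst : ∀ x, P.near K x y → {u | u ∈ T ∧ x - u ∈ (K : Set H)}.ncard = c := by
    rintro x ⟨k, hk, hx⟩
    have h1 : {u | u ∈ T ∧ x - u ∈ (K : Set H)} = {u | u ∈ T ∧ (x + k) - u ∈ (K : Set H)} := by
      ext u
      have : x + k - u = (x - u) + k := by abel
      simp only [Set.mem_ofPred_eq, SetLike.mem_coe, this, K.add_mem_cancel_right hk]
    rw [h1]
    exact P.count (fun x y hxy hx => P.trans (P.symm hxy) hx) (fun x y h hx => hK x y h hx) hx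
  have hcount : T.ncard * Nat.card K = {x | P.near K x y}.ncard * c := by
    have e1 : T.ncard * Nat.card K = (T ×ˢ (K : Set H)).ncard := by
      rw [Set.ncard_prod]; rfl
    rw [e1]
    have e2 : (T ×ˢ (K : Set H)).ncard
        = ∑ x ∈ {x | P.near K x y}.toFinset, {u | u ∈ T ∧ x - u ∈ (K : Set H)}.ncard := by
      rw [Set.ncard_eq_toFinset_card']
      rw [Finset.card_eq_sum_card_fiberwise (f := fun q : H × H => q.1 + q.2)
        (t := {x | P.near K x y}.toFinset)]
      · refine Finset.sum_congr rfl fun x hx => ?_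
        rw [Set.ncard_eq_toFinset_card']
        refine Finset.card_bij' (fun q _ => q.1) (fun u _ => (u, x - u)) ?_ ?_ ?_ ?_
        · rintro ⟨u, k⟩ h
          simp only [Finset.mem_filter, Set.mem_toFinset, Set.mem_prod] at h ⊢
          obtain ⟨⟨h1, h2⟩, rfl⟩ := h
          exact ⟨h1, by simpa using h2⟩
        · intro u h
          simp only [Finset.mem_filter, Set.mem_toFinset, Set.mem_prod] at h ⊢
          exact ⟨⟨h.1, h.2⟩, by abel⟩
        · rintro ⟨u, k⟩ h
          simp only [Finset.mem_filter, Set.mem_toFinset, Set.mem_prod] at h ⊢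
          obtain ⟨⟨h1, h2⟩, rfl⟩ := h
          simp
        · intro u h; rfl
      · rintro ⟨u, k⟩ h
        simp only [Set.coe_toFinset, Set.mem_prod, Set.mem_ofPred_eq] at h ⊢
        exact ⟨-k, K.neg_mem h.2, by simpa [hT] using h.1⟩
    rw [e2, Finset.sum_congr rfl (fun x hx => hconst x (by simpa using hx)), Finset.sum_const,
      Set.ncard_eq_toFinset_card', smul_eq_mul]
  rw [ha, hi, ← pow_add] at hcount
  obtain ⟨e, -, he⟩ := (Nat.dvd_prime_pow hp).1 (Dvd.intro _ hcount.symm)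
  exact ⟨e, he⟩

/-- The thin radical of the quotient `M ⧸ K` of `A`-subgroups is nontrivial: the basic sets of the
quotient have `p`-power size, and those outside the identity cannot all have size divisible by
`p`. -/
theorem exists_mem_thinMod [Finite H] (hp : p.Prime) {n : ℕ} (hH : Nat.card H = p ^ n)
    {K M : AddSubgroup H} (hK : P.Sat K) (hM : P.Sat M) (hKM : K < M) :
    ∃ y ∈ M, y ∉ K ∧ y ∈ P.thinMod K := by
  classical
  have := Fintype.ofFinite H
  by_contra! hcon
  obtain ⟨i, -, hi⟩ := card_subgroup hp hH K
  obtain ⟨j, -, hj⟩ := card_subgroup hp hH M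
  have hij : i < j := by
    have : Nat.card K < Nat.card M := by
      refine lt_of_le_of_ne (AddSubgroup.card_le_of_le hKM.le) fun h => hKM.ne ?_
      exact AddSubgroup.eq_of_le_of_card_ge hKM.le h.ge
    rw [hi, hj] at this
    exact (Nat.pow_lt_pow_iff_right hp.one_lt).1 this
  have hdvd : ∀ y ∈ M, y ∉ K → p ^ (i + 1) ∣ {x | P.near K x y}.ncard := by
    intro y hy hyK
    obtain ⟨e, he⟩ := P.card_near hp hH hK y
    rw [he]
    refine pow_dvd_pow p ?_
    by_contra! hlt
    refine hcon y hy hyK fun x hx => ?_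
    have hsub : (fun k => y + k) '' (K : Set H) ⊆ {x | P.near K x y} := by
      rintro _ ⟨k, hk, rfl⟩
      exact P.near_symm hK (P.near_add K y hk)
    have hcard : ((fun k => y + k) '' (K : Set H)).ncard = p ^ i := by
      rw [Set.ncard_image_of_injective _ (add_right_injective y), ← hi]; rfl
    have heq := Set.eq_of_subset_of_ncard_le hsub (by
      rw [hcard, he]; exact Nat.pow_le_pow_right hp.pos (by omega))
    have : x ∈ {x | P.near K x y} := P.near_of_rel K hx
    rw [← heq] at this
    obtain ⟨k, hk, rfl⟩ := this
    simpa using hk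
  -- the classes of `near` partition `M \ K`
  let s : Setoid H := ⟨P.near K, fun x => P.near_of_rel K (P.refl x), P.near_symm hK,
    P.near_trans hK⟩
  let D : Finset H := ((M : Set H) \ K).toFinset
  have hDsat : ∀ x y, P.near K x y → y ∈ D → x ∈ D := by
    rintro x y ⟨k, hk, h⟩ hy
    simp only [D, Set.mem_toFinset, Set.mem_sdiff, SetLike.mem_coe] at hy ⊢
    have h1 : x + k ∈ M := hM _ _ (P.symm h) hy.1
    refine ⟨by simpa [M.add_mem_cancel_right (hKM.le hk)] using h1, fun hx => hy.2 ?_⟩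
    exact hK _ _ h (K.add_mem hx hk)
  have hD : p ^ (i + 1) ∣ D.card := by
    rw [Finset.card_eq_sum_card_fiberwise (f := fun x => (Quotient.mk s x))
      (t := D.image (fun x => Quotient.mk s x)) (fun x hx => Finset.mem_coe.2
        (Finset.mem_image_of_mem _ hx))]
    refine Finset.dvd_sum fun q hq => ?_
    obtain ⟨y, hy, rfl⟩ := Finset.mem_image.1 hq
    have hy' := hy
    simp only [D, Set.mem_toFinset, Set.mem_sdiff, SetLike.mem_coe] at hy'
    have := hdvd y hy'.1 hy'.2
    rw [Set.ncard_eq_toFinset_card'] at this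
    refine (congrArg (fun F : Finset H => p ^ (i + 1) ∣ F.card) ?_).mp this
    ext x
    simp only [Finset.mem_filter, Set.mem_toFinset, Set.mem_ofPred_eq]
    constructor
    · intro h
      exact ⟨hDsat _ _ h hy, Quotient.sound h⟩
    · rintro ⟨-, h⟩
      exact Quotient.exact h
  have hDc : D.card + p ^ i = p ^ j := by
    have e1 : D.card = ((M : Set H) \ K).ncard := by rw [Set.ncard_eq_toFinset_card']
    have e2 := Set.ncard_sdiff_add_ncard_of_subset (s := (K : Set H)) (t := (M : Set H)) hKM.le
    have e3 : (K : Set H).ncard = p ^ i := hi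
    have e4 : (M : Set H).ncard = p ^ j := hj
    rw [e1]
    rw [e3, e4] at e2
    exact e2
  have h1 : p ^ (i + 1) ∣ p ^ j := pow_dvd_pow p hij
  rw [← hDc, Nat.dvd_add_right hD] at h1
  have := (Nat.pow_dvd_pow_iff_le_right hp.one_lt).1 h1
  omega

/-- A factor of order `p` of `A`-subgroups is thin. -/
theorem le_thinMod_of_card [Finite H] (hp : p.Prime) {n : ℕ} (hH : Nat.card H = p ^ n)
    {K M : AddSubgroup H} (hK : P.Sat K) (hM : P.Sat M) (hKM : K ≤ M)
    (hc : Nat.card M = p * Nat.card K) : M ≤ P.thinMod K := by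
  have hlt : K < M := by
    refine lt_of_le_of_ne hKM fun h => ?_
    subst h
    have h0 : 0 < Nat.card K := Nat.card_pos
    have := hp.one_lt
    nlinarith
  obtain ⟨y, hyM, hyK, hy⟩ := P.exists_mem_thinMod hp hH hK hM hlt
  have : M ⊓ P.thinMod K = M := by
    refine eq_of_lt_of_le_of_card hp (lt_of_le_of_ne (le_inf hKM (P.le_thinMod hK)) ?_)
      inf_le_left hc
    intro h
    exact hyK (h ▸ ⟨hyM, hy⟩)
  exact inf_eq_left.1 this

theorem card_sup_zmultiples [Finite H] (P : PSchurPartition p H) (hp : p.Prime) {n : ℕ}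
    (hH : Nat.card H = p ^ n) {K : AddSubgroup H} {y : H} (hy : y ∉ K) :
    Nat.card (K ⊔ AddSubgroup.zmultiples y : AddSubgroup H) = p * Nat.card K := by
  have hlt : K < K ⊔ AddSubgroup.zmultiples y := by
    refine lt_of_le_of_ne le_sup_left fun h => hy ?_
    rw [h]
    exact AddSubgroup.mem_sup_right (AddSubgroup.mem_zmultiples y)
  obtain ⟨i, -, hi⟩ := card_subgroup hp hH K
  obtain ⟨j, -, hj⟩ := card_subgroup hp hH (K ⊔ AddSubgroup.zmultiples y)
  have hij : i < j := by
    have : Nat.card K < Nat.card (K ⊔ AddSubgroup.zmultiples y : AddSubgroup H) := by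
      refine lt_of_le_of_ne (AddSubgroup.card_le_of_le hlt.le) fun h => hlt.ne ?_
      exact AddSubgroup.eq_of_le_of_card_ge hlt.le h.ge
    rw [hi, hj] at this
    exact (Nat.pow_lt_pow_iff_right hp.one_lt).1 this
  refine le_antisymm ?_ ?_
  · have hsurj : Function.Surjective (fun q : Fin p × K =>
        (⟨(q.1 : ℕ) • y + q.2, AddSubgroup.add_mem _ (AddSubgroup.mem_sup_right
          (AddSubgroup.nsmul_mem _ (AddSubgroup.mem_zmultiples y) _))
          (AddSubgroup.mem_sup_left q.2.2)⟩ : (K ⊔ AddSubgroup.zmultiples y : AddSubgroup H))) := by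
      rintro ⟨z, hz⟩
      obtain ⟨k, hk, w, hw, rfl⟩ := AddSubgroup.mem_sup.1 hz
      obtain ⟨m, rfl⟩ := AddSubgroup.mem_zmultiples_iff.1 hw
      have hp0 : (0 : ℤ) < p := by exact_mod_cast hp.pos
      have hm0 := Int.emod_nonneg m hp0.ne'
      refine ⟨(⟨(m % p).toNat, ?_⟩, ⟨k, hk⟩), ?_⟩
      · have := Int.emod_lt_of_pos m hp0
        omega
      · ext
        simp only
        have : ((m % p).toNat : ℕ) • y = m • y := by
          rw [← natCast_zsmul, Int.toNat_of_nonneg hm0, Int.emod_def, sub_smul, mul_smul,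
            natCast_zsmul, P.nsmul_eq_zero, sub_zero]
        rw [this, add_comm]
    have := Nat.card_le_card_of_surjective _ hsurj
    simpa using this
  · rw [hi, hj, ← pow_succ']
    exact Nat.pow_le_pow_right hp.pos hij

/-- `A`-subgroups extend to `A`-subgroups in which they have index `p`. -/
theorem exists_sat_card [Finite H] (hp : p.Prime) {n : ℕ} (hH : Nat.card H = p ^ n)
    {K : AddSubgroup H} (hK : P.Sat K) (hne : K ≠ ⊤) :
    ∃ M : AddSubgroup H, P.Sat M ∧ K ≤ M ∧ Nat.card M = p * Nat.card K := by
  obtain ⟨y, -, hyK, hy⟩ := P.exists_mem_thinMod hp hH hK P.sat_top (lt_top_iff_ne_top.2 hne)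
  refine ⟨K ⊔ AddSubgroup.zmultiples y, ?_, le_sup_left, P.card_sup_zmultiples hp hH hyK⟩
  exact P.sat_of_le_thinMod le_sup_left (sup_le (P.le_thinMod hK) (by simpa using hy))

end PSchurPartition
end SchurRing

/-! ### Sections, outer radicals and automorphisms -/

namespace SchurRing
namespace PSchurPartition

variable {p : ℕ} {H : Type*} [AddCommGroup H] [Finite H] (P : PSchurPartition p H)

theorem rel_add_of_thin {x x' t : H} (ht : t ∈ P.thinMod ⊥) (h : P.rel x x') :
    P.rel (x + t) (x' + t) := by
  obtain ⟨a, b, ha, hb, e⟩ := P.split (z := x) (z' := x') (u := x + t) (v := -t) h (by abel)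
  have : b = -t := by
    have := (P.thinMod ⊥).neg_mem ht b hb
    rwa [AddSubgroup.mem_bot, sub_eq_zero] at this
  have e' : a = x' + t := by rw [e, this]; abel
  rw [← e']
  exact P.symm ha

/-- The elements of the thin radical which stabilize the basic set of `t`. -/
def thinRad (t : H) : AddSubgroup H where
  carrier := {k | k ∈ P.thinMod ⊥ ∧ P.rel (t + k) t}
  add_mem' := by
    rintro a b ⟨ha, ha'⟩ ⟨hb, hb'⟩
    refine ⟨AddSubgroup.add_mem _ ha hb, ?_⟩
    have := P.rel_add_of_thin hb ha'
    rw [add_assoc] at this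
    exact P.trans this hb'
  zero_mem' := ⟨AddSubgroup.zero_mem _, by simpa using P.refl t⟩
  neg_mem' := by
    rintro a ⟨ha, ha'⟩
    refine ⟨AddSubgroup.neg_mem _ ha, ?_⟩
    have := P.rel_add_of_thin (AddSubgroup.neg_mem _ ha) ha'
    simp only [add_neg_cancel_right] at this
    exact P.symm this

theorem mem_thinRad {t k : H} : k ∈ P.thinRad t ↔ k ∈ P.thinMod ⊥ ∧ P.rel (t + k) t := Iff.rfl

theorem thinRad_le_thinMod (t : H) : P.thinRad t ≤ P.thinMod ⊥ := fun _ h => h.1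

theorem sat_thinRad (t : H) : P.Sat (P.thinRad t) :=
  P.sat_of_le_thinMod bot_le (P.thinRad_le_thinMod t)

theorem thinRad_congr {t t' : H} (h : P.rel t t') : P.thinRad t = P.thinRad t' := by
  ext k
  simp only [mem_thinRad]
  refine and_congr_right fun hk => ⟨fun h1 => ?_, fun h1 => ?_⟩
  · exact P.trans (P.trans (P.symm (P.rel_add_of_thin hk h)) h1) h
  · exact P.trans (P.trans (P.rel_add_of_thin hk h) h1) (P.symm h)

theorem thinRad_add {t s : H} (hs : s ∈ P.thinMod ⊥) : P.thinRad (t + s) = P.thinRad t := by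
  ext k
  simp only [mem_thinRad]
  refine and_congr_right fun hk => ⟨fun h1 => ?_, fun h1 => ?_⟩
  · have := P.rel_add_of_thin (AddSubgroup.neg_mem _ hs) h1
    have e : t + s + k + -s = t + k := by abel
    rwa [e, add_neg_cancel_right] at this
  · have := P.rel_add_of_thin hs h1
    have e : t + k + s = t + s + k := by abel
    rwa [e] at this

theorem thinRad_le_zsmul (t : H) (m : ℤ) : ∀ k ∈ P.thinRad t, m • k ∈ P.thinRad (m • t) := by
  rintro k ⟨hk, h⟩
  refine ⟨AddSubgroup.zsmul_mem _ hk m, ?_⟩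
  rw [← smul_add]
  exact P.zsmul m h

theorem thinRad_zsmul {m m' : ℤ} (hm : ∀ x : H, m' • m • x = x ∧ m • m' • x = x) (t : H) :
    P.thinRad (m • t) = P.thinRad t := by
  ext k
  constructor
  · intro h
    have := P.thinRad_le_zsmul _ m' k h
    rw [(hm t).1] at this
    simpa [(hm k).2] using AddSubgroup.zsmul_mem _ this m
  · intro h
    have := AddSubgroup.zsmul_mem _ h m'
    have := P.thinRad_le_zsmul _ m _ this
    rwa [(hm k).2] at this

/-- The basic set of `t` meets every coset of `L` in at most one element. -/
def IsSection (L : AddSubgroup H) (t : H) : Prop := ∀ k ∈ L, P.rel (t + k) t → k = 0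

section IsSection
variable {P} {L : AddSubgroup H}

theorem IsSection.of_rel (hL : L ≤ P.thinMod ⊥) {t t' : H} (ht : P.IsSection L t)
    (h : P.rel t t') : P.IsSection L t' := fun k hk h1 =>
  ht k hk ((P.thinRad_congr h).ge ⟨hL hk, h1⟩).2

theorem IsSection.add_of_thin (hL : L ≤ P.thinMod ⊥) {t s : H} (ht : P.IsSection L t)
    (hs : s ∈ P.thinMod ⊥) : P.IsSection L (t + s) := fun k hk h1 =>
  ht k hk ((P.thinRad_add hs).le ⟨hL hk, h1⟩).2

theorem IsSection.zsmul (hL : L ≤ P.thinMod ⊥) {m m' : ℤ}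
    (hm : ∀ x : H, m' • m • x = x ∧ m • m' • x = x) {t : H} (ht : P.IsSection L t) :
    P.IsSection L (m • t) := fun k hk h1 =>
  ht k hk ((P.thinRad_zsmul hm t).le ⟨hL hk, h1⟩).2

theorem isSection_of_not_rel (hp : p.Prime) (hL : L ≤ P.thinMod ⊥) (hc : Nat.card L = p)
    {t k : H} (hk : k ∈ L) (h : ¬ P.rel (t + k) t) : P.IsSection L t := by
  intro k' hk' h'
  by_contra hne
  obtain ⟨m, hm⟩ := exists_zsmul_sub_mem hp (K := ⊥) (M := L) bot_le (by simpa using hc) hk'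
    (by simpa using hne) hk
  rw [AddSubgroup.mem_bot, sub_eq_zero] at hm
  apply h
  have : k' ∈ P.thinRad t := ⟨hL hk', h'⟩
  rw [hm]
  exact (AddSubgroup.zsmul_mem _ this m).2

theorem IsSection.eq_of_rel (hL : L ≤ P.thinMod ⊥) {t a b : H} (ht : P.IsSection L t)
    (ha : P.rel a t) (hb : P.rel b t) (hab : a - b ∈ L) : a = b := by
  have := ht.of_rel hL (P.symm hb) (a - b) hab (by simpa using P.trans ha (P.symm hb))
  exact sub_eq_zero.1 this

end IsSection

section IsAut
variable {P} {g : H → H}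

theorem IsAut.sub_sub_mem (hg : P.IsAut g) {K : AddSubgroup H} {x y : H}
    (h : x - y ∈ P.thinMod K) : g x - g y - (x - y) ∈ K := h _ (hg x y)

/-- The increments of an automorphism along a subgroup `W` that is thin modulo `L` are the same at
two points whose difference lies in a basic set that is a section over `L`. -/
theorem IsAut.add_sub_eq (hg : P.IsAut g) {L W : AddSubgroup H} (hL : L ≤ P.thinMod ⊥)
    (hW : W ≤ P.thinMod L) {z z' u : H} (hu : u ∈ W) (h : P.IsSection L (z' - z)) :
    g (z' + u) - g z' = g (z + u) - g z := by
  have h1 : P.rel (g (z' + u) - g (z + u)) (z' - z) := by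
    have := hg (z' + u) (z + u)
    rwa [add_sub_add_right_eq_sub] at this
  have h2 := hg z' z
  have h3 := hg.sub_sub_mem (x := z' + u) (y := z') (K := L) (by simpa using hW hu)
  have h4 := hg.sub_sub_mem (x := z + u) (y := z) (K := L) (by simpa using hW hu)
  have h5 := h.eq_of_rel hL h1 h2 (by
    have := L.sub_mem h3 h4
    have e : g (z' + u) - g z' - (z' + u - z') - (g (z + u) - g z - (z + u - z))
      = g (z' + u) - g (z + u) - (g z' - g z) := by abel
    rwa [e] at this)
  have e : g (z' + u) - g z' - (g (z + u) - g z)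
      = g (z' + u) - g (z + u) - (g z' - g z) := by abel
  rw [← sub_eq_zero, e, h5, sub_self]

end IsAut

/-- The elements of `K` which stabilize, modulo `L`, all the basic sets that meet `C`. -/
def setRad {L : AddSubgroup H} (hL : P.Sat L) (K : AddSubgroup H) (C : Set H)
    (hC : ∀ t ∈ C, ∀ k ∈ K, t + k ∈ C) : AddSubgroup H where
  carrier := {k | k ∈ K ∧ ∀ t ∈ C, P.near L (t + k) t}
  add_mem' := by
    rintro a b ⟨ha, ha'⟩ ⟨hb, hb'⟩
    refine ⟨K.add_mem ha hb, fun t ht => ?_⟩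
    have := hb' (t + a) (hC t ht a ha)
    rw [add_assoc] at this
    exact P.near_trans hL this (ha' t ht)
  zero_mem' := ⟨K.zero_mem, fun t _ => P.near_of_rel L (by simpa using P.refl t)⟩
  neg_mem' := by
    rintro a ⟨ha, ha'⟩
    refine ⟨K.neg_mem ha, fun t ht => ?_⟩
    have := ha' (t + -a) (hC t ht _ (K.neg_mem ha))
    rw [neg_add_cancel_right] at this
    exact P.near_symm hL this

/-- The elements of `K` which stabilize, modulo `L`, all the basic sets in `M \ K`. -/
def outerRad {L : AddSubgroup H} (hL : P.Sat L) {K M : AddSubgroup H} (hKM : K ≤ M) :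
    AddSubgroup H :=
  P.setRad hL K ((M : Set H) \ K) (diff_add_mem hKM)

section outerRad
variable {P} {L K M : AddSubgroup H} {hL : P.Sat L} {hKM : K ≤ M}

theorem mem_outerRad {k : H} :
    k ∈ P.outerRad hL hKM ↔ k ∈ K ∧ ∀ t ∈ M, t ∉ K → P.near L (t + k) t :=
  ⟨fun h => ⟨h.1, fun t h1 h2 => h.2 t ⟨h1, h2⟩⟩, fun h => ⟨h.1, fun t ht => h.2 t ht.1 ht.2⟩⟩

theorem le_outerRad (h : L ≤ K) : L ≤ P.outerRad hL hKM := fun _ hk =>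
  mem_outerRad.2 ⟨h hk, fun t _ _ => P.near_symm hL (P.near_add L t hk)⟩

theorem sat_outerRad (hK : P.Sat K) (hM : P.Sat M) : P.Sat (P.outerRad hL hKM) := by
  intro k k' hkk hk
  obtain ⟨h1, h2⟩ := mem_outerRad.1 hk
  refine mem_outerRad.2 ⟨hK _ _ hkk h1, fun t ht htK => ?_⟩
  obtain ⟨s, v, hs, hv, e⟩ := P.split (P.symm hkk) (u := t + k') (v := -t) (by abel)
  have hv' : P.rel (-v) t := by simpa using P.neg hv
  have h3 : -v ∈ M := hM _ _ (P.symm hv') ht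
  have h4 : -v ∉ K := fun h => htK (hK _ _ hv' h)
  have h5 := h2 _ h3 h4
  have e2 : -v + k = s := by rw [e]; abel
  rw [e2] at h5
  exact P.near_trans hL (P.near_of_rel L (P.symm hs))
    (P.near_trans hL h5 (P.near_of_rel L hv'))

/-- If an automorphism is trivial modulo `L` on a coset of a subgroup `K` of index `p` in `M`, then
it moves the points of the other cosets in `M` by elements which stabilize all the basic sets in
`M \ K` modulo `L`: seen from `z` and from `g z`, each point of the fixed coset lies, modulo `L`, in
the same basic set, and the multipliers carry this over to all of `M \ K`. -/
theorem IsAut.sub_mem_outerRad (hp : p.Prime) {n : ℕ} (hH : Nat.card H = p ^ n)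
    (hL : P.Sat L) (hK : P.Sat K) (hM : P.Sat M) (hLK : L ≤ K) (hKM : K ≤ M)
    (hc : Nat.card M = p * Nat.card K) {g : H → H} (hg : P.IsAut g) {x : H}
    (hx : ∀ y, y - x ∈ K → g y - y ∈ L) {z : H} (hz : z - x ∈ M) (hzK : z - x ∉ K) :
    g z - z ∈ P.outerRad hL hKM := by
  have hthin := P.le_thinMod_of_card hp hH hK hM hKM hc
  set η := g z - z with hη
  have hηK : η ∈ K := by
    have h1 := hg.sub_sub_mem (hthin hz)
    have h2 := hLK (hx x (by simp))
    have e : η = (g z - g x - (z - x)) + (g x - x) := by rw [hη]; abel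
    rw [e]
    exact K.add_mem h1 h2
  have hxM : x - z ∈ M := by simpa using M.neg_mem hz
  have hxK : x - z ∉ K := fun h => hzK (by simpa using K.neg_mem h)
  let C : Set H := {t | t - (x - z) ∈ K}
  have hC : ∀ t ∈ C, ∀ k ∈ K, t + k ∈ C := by
    intro t ht k hk
    have e : t + k - (x - z) = (t - (x - z)) + k := by abel
    change t + k - (x - z) ∈ K
    rw [e]
    exact K.add_mem ht hk
  have h1 : -η ∈ P.setRad hL K C hC := by
    refine ⟨K.neg_mem hηK, fun t ht => ?_⟩
    have hy : z + t - x ∈ K := by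
      have e : z + t - x = t - (x - z) := by abel
      rw [e]; exact ht
    refine ⟨g (z + t) - (z + t), hx _ hy, ?_⟩
    have := hg (z + t) z
    rw [add_sub_cancel_left] at this
    have e : t + -η + (g (z + t) - (z + t)) = g (z + t) - g z := by rw [hη]; abel
    rwa [e]
  have h2 : ∀ m : ℤ, m • η ∈ P.setRad hL K C hC := fun m => by
    simpa using AddSubgroup.zsmul_mem _ h1 (-m)
  refine mem_outerRad.2 ⟨hηK, fun t ht htK => ?_⟩
  obtain ⟨m, m', hm, hmt⟩ := P.exists_unit_zsmul_sub_mem hp hKM hc hxM hxK ht htK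
  have h3 : m' • t ∈ C := by
    have := K.zsmul_mem hmt m'
    rw [smul_sub, (hm _).1] at this
    exact this
  have h4 := P.near_zsmul L m ((h2 m').2 _ h3)
  rwa [smul_add, (hm _).2, (hm _).2] at h4

end outerRad

/-- Indecomposability: the S-ring is not a proper generalized wreath product. -/
def Indecomposable : Prop := ∀ E F : AddSubgroup H, P.Sat E → P.Sat F → F ≤ E → E ≠ ⊤ → F ≠ ⊥ →
  ∃ x, x ∉ E ∧ ∃ f ∈ F, ¬ P.rel (x + f) x

section Indecomposable
variable {P} (hind : P.Indecomposable)
include hind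

/-- In an indecomposable S-ring, an automorphism which fixes all points of a coset of an
`A`-subgroup of index `p` is trivial. -/
theorem Indecomposable.eq_of_fixed (hp : p.Prime) {n : ℕ} (hH : Nat.card H = p ^ n)
    {E : AddSubgroup H} (hE : P.Sat E) (hc : Nat.card H = p * Nat.card E) {g : H → H}
    (hg : P.IsAut g) {x : H} (hx : ∀ y, y - x ∈ E → g y = y) (z : H) : g z = z := by
  by_cases hz : z - x ∈ E
  · exact hx z hz
  have hc' : Nat.card (⊤ : AddSubgroup H) = p * Nat.card E := by
    rw [AddSubgroup.card_top, hc]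
  have h := hg.sub_mem_outerRad hp hH P.sat_bot hE P.sat_top bot_le le_top hc' (x := x)
    (fun y hy => by simp [hx y hy]) (z := z) trivial hz
  by_contra hne
  have hE' : E ≠ ⊤ := by
    rintro rfl
    exact hz trivial
  obtain ⟨t, htE, f, hf, hrel⟩ := hind E (P.outerRad P.sat_bot le_top) hE
    (sat_outerRad hE P.sat_top) (fun _ hk => (mem_outerRad.1 hk).1) hE' (by
      intro h0
      rw [h0, AddSubgroup.mem_bot, sub_eq_zero] at h
      exact hne h)
  exact hrel (P.near_bot.1 ((mem_outerRad.1 hf).2 t trivial htE))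

/-- The basic sets that are sections over a thin subgroup of order `p` generate the group. -/
theorem Indecomposable.closure_isSection (hp : p.Prime) {L : AddSubgroup H}
    (hL : L ≤ P.thinMod ⊥) (hc : Nat.card L = p) :
    AddSubgroup.closure {t | P.IsSection L t} = ⊤ := by
  set E := AddSubgroup.closure {t | P.IsSection L t} with hE
  by_contra hne
  have hbot : L ≠ ⊥ := by
    rintro rfl
    simp only [AddSubgroup.card_bot] at hc
    exact hp.one_lt.ne hc
  have hsat : P.Sat E := by
    intro x y hxy hx
    revert y
    refine AddSubgroup.closure_induction (p := fun x _ => ∀ y, P.rel x y → y ∈ E)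
      ?_ ?_ ?_ ?_ hx
    · intro t ht y hy
      exact AddSubgroup.subset_closure (IsSection.of_rel hL ht hy)
    · intro y hy
      rw [P.eq_zero (P.symm hy)]
      exact E.zero_mem
    · intro a b _ _ ha hb y hy
      obtain ⟨a', b', ha', hb', rfl⟩ := P.split hy rfl
      exact E.add_mem (ha _ (P.symm ha')) (hb _ (P.symm hb'))
    · intro a _ ha y hy
      have := ha (-y) (by simpa using P.neg hy)
      simpa using E.neg_mem this
  have hLE : L ≤ E := by
    intro l hl
    refine AddSubgroup.subset_closure fun k _ h => ?_
    have := hL hl _ h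
    simpa using this
  obtain ⟨x, hx, f, hf, h⟩ := hind E L hsat (P.sat_of_le_thinMod bot_le hL) hLE hne hbot
  exact hx (AddSubgroup.subset_closure (isSection_of_not_rel hp hL hc hf h))

/-- An automorphism fixing `0` which is trivial modulo a thin subgroup of order `p` is trivial. -/
theorem Indecomposable.eq_of_sub_mem (hp : p.Prime) {L : AddSubgroup H}
    (hL : L ≤ P.thinMod ⊥) (hc : Nat.card L = p) {g : H → H} (hg : P.IsAut g) (h0 : g 0 = 0)
    (hgL : ∀ z, g z - z ∈ L) (z : H) : g z = z := by
  have hz : z ∈ AddSubgroup.closure {t | P.IsSection L t} := by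
    rw [hind.closure_isSection hp hL hc]; trivial
  have key : ∀ t, P.IsSection L t → ∀ z, g (z + t) - (z + t) = g z - z := by
    intro t ht z
    have h1 := hg (z + t) z
    rw [add_sub_cancel_left] at h1
    have h2 := ht.eq_of_rel hL h1 (P.refl t) (by
      have := L.sub_mem (hgL (z + t)) (hgL z)
      have e : g (z + t) - (z + t) - (g z - z) = g (z + t) - g z - t := by abel
      rwa [e] at this)
    have e : g (z + t) - (z + t) - (g z - z) = g (z + t) - g z - t := by abel
    rw [← sub_eq_zero, e, h2, sub_self]
  have key2 : ∀ w, g (w + z) - (w + z) = g w - w := by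
    refine AddSubgroup.closure_induction (p := fun z _ => ∀ w, g (w + z) - (w + z) = g w - w)
      ?_ ?_ ?_ ?_ hz
    · exact fun t ht w => key t ht w
    · intro w; simp
    · intro a b _ _ ha hb w
      rw [← add_assoc, hb, ha]
    · intro a _ ha w
      have := ha (w + -a)
      rw [neg_add_cancel_right] at this
      exact this.symm
  have := key2 0
  simp only [zero_add, h0, sub_self] at this
  exact sub_eq_zero.1 this

end Indecomposable

/-- A function which changes along the directions `t₁`, `t₂` and `t₁ + t₂` by elements of three
independent subgroups is determined by its values at `0` and `t₁`. -/
theorem eq_zero_of_three_directions {H : Type*} [AddCommGroup H] {c : H → H} {t₁ t₂ : H}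
    {F₁ F₂ F₃ : AddSubgroup H} (h12 : ∀ x ∈ F₁, x ∈ F₂ → x = 0) (h13 : ∀ x ∈ F₁, x ∈ F₃ → x = 0)
    (h23 : ∀ x ∈ F₂, x ∈ F₃ → x = 0) (h1 : ∀ z, c (z + t₁) - c z ∈ F₁)
    (h2 : ∀ z, c (z + t₂) - c z ∈ F₂) (h3 : ∀ z, c (z + (t₁ + t₂)) - c z ∈ F₃)
    (h0 : c 0 = 0) (ht : c t₁ = 0) (i j : ℤ) : c (i • t₁ + j • t₂) = 0 := by
  have many : ∀ (F : AddSubgroup H) (t : H), (∀ z, c (z + t) - c z ∈ F) → ∀ (i : ℤ) (z : H),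
      c (z + i • t) - c z ∈ F := by
    intro F t h i
    induction i using Int.induction_on with
    | zero => intro z; simp
    | succ i ih =>
      intro z
      have := F.add_mem (h (z + (i : ℤ) • t)) (ih z)
      have e : z + ((i : ℤ) + 1) • t = z + (i : ℤ) • t + t := by rw [add_smul, one_smul]; abel
      rw [e]
      simpa using this
    | pred i ih =>
      intro z
      have := F.sub_mem (ih z) (h (z + (-(i : ℤ) - 1) • t))
      have e : z + (-(i : ℤ) - 1) • t + t = z + (-(i : ℤ)) • t := by
        rw [sub_smul, one_smul]; abel
      rw [e] at this
      simpa using this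
  have m1 := many F₁ t₁ h1
  have m2 := many F₂ t₂ h2
  have a1 : ∀ i : ℤ, c (i • t₁) ∈ F₁ := fun i => by simpa [h0] using m1 i 0
  have a2 : ∀ j : ℤ, c (j • t₂) ∈ F₂ := fun i => by simpa [h0] using m2 i 0
  have hadd : ∀ i j : ℤ, c (i • t₁ + j • t₂) = c (i • t₁) + c (j • t₂) := by
    intro i j
    have e1 := F₂.sub_mem (m2 j (i • t₁)) (a2 j)
    have e2 := F₁.sub_mem (m1 i (j • t₂)) (a1 i)
    rw [add_comm (j • t₂)] at e2
    have e : c (i • t₁ + j • t₂) - c (j • t₂) - c (i • t₁)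
      = c (i • t₁ + j • t₂) - c (i • t₁) - c (j • t₂) := by abel
    rw [e] at e2
    have := h12 _ e2 e1
    rw [sub_sub, sub_eq_zero] at this
    exact this
  have hdiff : ∀ i j : ℤ,
      (c ((i + 1) • t₁) - c (i • t₁)) + (c ((j + 1) • t₂) - c (j • t₂)) ∈ F₃ := by
    intro i j
    have := h3 (i • t₁ + j • t₂)
    have e : i • t₁ + j • t₂ + (t₁ + t₂) = (i + 1) • t₁ + (j + 1) • t₂ := by
      rw [add_smul, add_smul, one_smul, one_smul]; abel
    rw [e, hadd, hadd] at this
    convert this using 1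
    abel
  have d1 : ∀ i : ℤ, c ((i + 1) • t₁) - c (i • t₁) ∈ F₁ := fun i => F₁.sub_mem (a1 _) (a1 _)
  have d2 : ∀ i : ℤ, c ((i + 1) • t₂) - c (i • t₂) ∈ F₂ := fun i => F₂.sub_mem (a2 _) (a2 _)
  have q : ∀ j : ℤ, c ((j + 1) • t₂) - c (j • t₂) = 0 := by
    intro j
    refine h23 _ (d2 j) ?_
    have := hdiff 0 j
    simpa [ht, h0] using this
  have r : ∀ i : ℤ, c ((i + 1) • t₁) - c (i • t₁) = 0 := by
    intro i
    refine h13 _ (d1 i) ?_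
    have := hdiff i 0
    rwa [q, add_zero] at this
  have const : ∀ t : H, (∀ i : ℤ, c ((i + 1) • t) - c (i • t) = 0) → ∀ i : ℤ, c (i • t) = 0 := by
    intro t ht i
    induction i using Int.induction_on with
    | zero => simpa using h0
    | succ i ih => rw [← ih]; exact sub_eq_zero.1 (ht i)
    | pred i ih =>
      have := ht (-(i : ℤ) - 1)
      rw [sub_add_cancel, ih, zero_sub, neg_eq_zero] at this
      exact this
  rw [hadd, const t₁ r, const t₂ q, add_zero]

end PSchurPartition
end SchurRing

/-! ### Base points: thin radical of order at least `p ^ 2` -/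

namespace SchurRing
namespace PSchurPartition

variable {p : ℕ} {H : Type*} [AddCommGroup H] [Finite H] (P : PSchurPartition p H)

theorem thinMod_mono {K M : AddSubgroup H} (h : K ≤ M) : P.thinMod K ≤ P.thinMod M :=
  fun _ hy x hx => h (hy x hx)

theorem sat_thinMod {K : AddSubgroup H} (hK : P.Sat K) : P.Sat (P.thinMod K) :=
  P.sat_of_le_thinMod (P.le_thinMod hK) le_rfl

/-- The elements of `U` which stabilize the intersection of the basic set of `t` with `t + U`. For
`U = ⊤` this is the radical of the basic set of `t`. -/
def rowStab (U : AddSubgroup H) (t : H) : AddSubgroup H where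
  carrier := {s | s ∈ U ∧ ∀ d ∈ U, P.rel (t + d) t → P.rel (t + d + s) t}
  add_mem' := by
    rintro a b ⟨ha, ha'⟩ ⟨hb, hb'⟩
    refine ⟨U.add_mem ha hb, fun d hd h => ?_⟩
    have := hb' (d + a) (U.add_mem hd ha) (by rw [← add_assoc]; exact ha' d hd h)
    convert this using 1
    abel
  zero_mem' := ⟨U.zero_mem, fun d _ h => by simpa using h⟩
  neg_mem' := by
    rintro a ⟨ha, ha'⟩
    refine ⟨U.neg_mem ha, fun d hd h => ?_⟩
    have key : ∀ n : ℕ, P.rel (t + d + n • a) t := by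
      intro n
      induction n with
      | zero => simpa using h
      | succ n ih =>
        rw [add_assoc] at ih
        have := ha' _ (U.add_mem hd (U.nsmul_mem ha n)) ih
        rw [succ_nsmul]
        convert this using 1
        abel
    have h1 : (addOrderOf a - 1 + 1) • a = 0 := by
      rw [Nat.sub_add_cancel (addOrderOf_pos a), addOrderOf_nsmul_eq_zero]
    rw [succ_nsmul] at h1
    rw [← eq_neg_of_add_eq_zero_left h1]
    exact key _

/-- The radical of a basic set is an `A`-subgroup. -/
theorem sat_rowStab_top (t : H) : P.Sat (P.rowStab ⊤ t) := by
  rintro w w' hw ⟨-, h⟩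
  refine ⟨trivial, fun d _ hd => ?_⟩
  obtain ⟨s, v, hs, hv, e⟩ := P.split (P.symm hw) (u := t + d + w') (v := -(t + d)) (by abel)
  have hv' : P.rel (-v) t := P.trans (by simpa using P.neg hv) hd
  have h1 := h (-v - t) trivial (by simpa using hv')
  have e2 : t + (-v - t) + w = s := by rw [e]; abel
  rw [e2] at h1
  exact P.trans (P.symm hs) h1

/-- The elements `t` such that `g` commutes with the translation by `t`. -/
def periods {H : Type*} [AddCommGroup H] (g : H → H) : AddSubgroup H where
  carrier := {t | ∀ z, g (z + t) = g z + t}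
  add_mem' := by
    intro a b ha hb z
    rw [← add_assoc, hb, ha, add_assoc]
  zero_mem' := by intro z; simp
  neg_mem' := by
    intro a ha z
    have := ha (z + -a)
    rw [neg_add_cancel_right] at this
    rw [this]; abel

section
variable {P} {g : H → H}

theorem IsAut.thin_le_periods (hg : P.IsAut g) : P.thinMod ⊥ ≤ periods g := by
  intro t ht z
  have := hg.sub_sub_mem (x := z + t) (y := z) (K := ⊥) (by simpa using ht)
  rw [AddSubgroup.mem_bot, sub_eq_zero, add_sub_cancel_left, sub_eq_iff_eq_add] at this
  rw [this, add_comm]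

/-- An automorphism fixing `0` and `x` fixes all points of the basic set of `x`, if this basic set
is a section over `K` in a coset of a subgroup that is thin modulo `K`. -/
theorem IsAut.eq_of_section (hg : P.IsAut g) (h0 : g 0 = 0) {K M : AddSubgroup H} {x : H}
    (hxM : x ∈ P.thinMod M) (hMK : M ≤ P.thinMod K)
    (hs : ∀ a b, P.rel a x → P.rel b x → a - b ∈ K → a = b) (hx : g x = x) {y : H}
    (hyx : P.rel y x) : g y = y := by
  refine hs _ _ (P.trans (hg.rel_self h0 y) hyx) hyx ?_
  have := hg.sub_sub_mem (hMK (hxM y hyx))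
  rw [hx] at this
  simpa using this

end

section
variable {P}

/-- The size of a basic set which is a section over `K`. -/
theorem card_mul_le {K M : AddSubgroup H} {x : H} (hKM : K ≤ M) (hx : x ∈ P.thinMod M)
    (hs : ∀ a b, P.rel a x → P.rel b x → a - b ∈ K → a = b) :
    {y | P.rel y x}.ncard * Nat.card K ≤ Nat.card M := by
  have e1 : {y | P.rel y x}.ncard * Nat.card K = ({y | P.rel y x} ×ˢ (K : Set H)).ncard := by
    rw [Set.ncard_prod]; rfl
  have e2 : Nat.card M = (M : Set H).ncard := rfl
  rw [e1, e2]
  refine Set.ncard_le_ncard_of_injOn (fun q => q.1 + q.2 - x) ?_ ?_ (Set.toFinite _)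
  · rintro ⟨a, k⟩ ⟨ha, hk⟩
    have := M.add_mem (hx a ha) (hKM hk)
    have e : a + k - x = a - x + k := by abel
    simpa [e] using this
  · rintro ⟨a, k⟩ ⟨ha, hk⟩ ⟨a', k'⟩ ⟨ha', hk'⟩ h
    simp only [sub_left_inj] at h
    have hab : a - a' = k' - k := by
      rw [sub_eq_sub_iff_add_eq_add, h, add_comm]
    have h1 : a = a' := hs a a' ha ha' (by rw [hab]; exact K.sub_mem hk' hk)
    subst h1
    simpa using h

/-- In a coset of `M`, a basic set which is not in a coset of the subgroup `K` of index `p` meets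
all the cosets of `K`. -/
theorem near_of_notMem_thinMod (hp : p.Prime) {n : ℕ} (hH : Nat.card H = p ^ n)
    {K M : AddSubgroup H} (hK : P.Sat K) (hKM : K ≤ M) (hc : Nat.card M = p * Nat.card K) {x : H}
    (hxM : x ∈ P.thinMod M) (hxK : x ∉ P.thinMod K) {y : H} (hy : y - x ∈ M) :
    P.near K y x := by
  obtain ⟨e, he⟩ := P.card_near hp hH hK x
  obtain ⟨i, -, hi⟩ := card_subgroup hp hH K
  have hsub : {y | P.near K y x} ⊆ (fun k => x + k) '' (M : Set H) := by
    rintro y ⟨k, hk, h⟩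
    refine ⟨y - x, ?_, by simp⟩
    have := M.sub_mem (hxM _ h) (hKM hk)
    have e : y + k - x - k = y - x := by abel
    rwa [e] at this
  have hsub' : (fun k => x + k) '' (K : Set H) ⊂ {y | P.near K y x} := by
    constructor
    · rintro _ ⟨k, hk, rfl⟩
      exact P.near_symm hK (P.near_add K x hk)
    · intro h
      refine hxK fun y hy => ?_
      obtain ⟨k, hk, rfl⟩ := h (P.near_of_rel K hy)
      simpa using hk
  have h1 : ((fun k => x + k) '' (K : Set H)).ncard = p ^ i := by
    rw [Set.ncard_image_of_injective _ (add_right_injective x), ← hi]; rfl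
  have h2 : ((fun k => x + k) '' (M : Set H)).ncard = p ^ (i + 1) := by
    rw [Set.ncard_image_of_injective _ (add_right_injective x), pow_succ', ← hi, ← hc]; rfl
  have h3 := Set.ncard_lt_ncard hsub'
  rw [h1, he, Nat.pow_lt_pow_iff_right hp.one_lt] at h3
  have h4 := Set.eq_of_subset_of_ncard_le hsub (by
    rw [h2, he]; exact Nat.pow_le_pow_right hp.pos h3)
  have : y ∈ (fun k => x + k) '' (M : Set H) := ⟨y - x, hy, by simp⟩
  rwa [← h4] at this

theorem eq_zero_of_mem_of_mem (hp : p.Prime) {F G : AddSubgroup H} (hF : Nat.card F = p)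
    (hG : Nat.card G = p) (hne : F ≠ G) : ∀ x ∈ F, x ∈ G → x = 0 := by
  intro x hx hx'
  by_contra h0
  have hlt : (⊥ : AddSubgroup H) < F ⊓ G := by
    refine bot_lt_iff_ne_bot.2 fun h => h0 ?_
    have : x ∈ F ⊓ G := ⟨hx, hx'⟩
    rwa [h, AddSubgroup.mem_bot] at this
  have h1 := eq_of_lt_of_le_of_card hp hlt inf_le_left (by simpa using hF)
  have h2 := eq_of_lt_of_le_of_card hp hlt inf_le_right (by simpa using hG)
  exact hne (h1.symm.trans h2)

theorem card_eq_of_lt_of_lt (hp : p.Prime) {F W : AddSubgroup H} (hW : Nat.card W = p ^ 2)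
    (h0 : F ≠ ⊥) (h1 : F ≤ W) (h2 : F ≠ W) : Nat.card F = p := by
  obtain ⟨i, hi, h⟩ := (Nat.dvd_prime_pow hp).1 (hW ▸ AddSubgroup.card_dvd_of_le h1)
  interval_cases i
  · rw [pow_zero, AddSubgroup.card_eq_one] at h
    exact absurd h h0
  · simpa using h
  · exact absurd (AddSubgroup.eq_of_le_of_card_ge h1 (by rw [h, hW])) h2

end

/-- The only automorphism that fixes `0` and `x` is the identity. -/
def IsBase (x : H) : Prop := ∀ g : H → H, P.IsAut g → g 0 = 0 → g x = x → ∀ z, g z = z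

section cases
variable {P} (hp : p.Prime) (hH : Nat.card H = p ^ 4) (hind : P.Indecomposable)
include hp hH hind

/-- The thin radical `W` has order `p²` and `H ⧸ W` is thin. Then the basic set of `t` is a coset
`t + R t` of a subgroup of `W`. Indecomposability provides two directions `t₁`, `t₂` such that
`R t₁`, `R t₂` and `R (t₁ + t₂)` are different subgroups of order `p`. -/
theorem exists_base_of_thinMod_eq_top (hO : Nat.card (P.thinMod ⊥) = p ^ 2)
    (htop : P.thinMod (P.thinMod ⊥) = ⊤) :
    ∃ x, {y | P.rel y x}.ncard ≤ p ∧ P.IsBase x := by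
  set W := P.thinMod ⊥ with hW
  have hWsat : P.Sat W := P.sat_thinMod P.sat_bot
  have hthin : ∀ x y, P.rel y x → y - x ∈ P.thinRad x := fun x y h =>
    ⟨(htop ▸ AddSubgroup.mem_top x : x ∈ P.thinMod W) y h, by simpa using h⟩
  have hWtop : W ≠ ⊤ := by
    intro h
    rw [h, AddSubgroup.card_top, hH] at hO
    exact absurd (Nat.pow_right_injective hp.two_le hO) (by norm_num)
  have hWbot : W ≠ ⊥ := by
    intro h
    rw [h, AddSubgroup.card_bot] at hO
    exact absurd (Nat.one_lt_pow two_ne_zero hp.one_lt) (by omega)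
  have hne : ∀ t, t ∉ W → P.thinRad t ≠ ⊥ := by
    intro t ht h
    refine ht fun x hx => ?_
    rw [← h]
    exact hthin t x hx
  have hcard : ∀ t, t ∉ W → P.thinRad t ≠ W → Nat.card (P.thinRad t) = p := fun t ht h =>
    card_eq_of_lt_of_lt hp hO (hne t ht) (P.thinRad_le_thinMod t) h
  have hnot : ∀ {t f}, f ∈ W → ¬ P.rel (t + f) t → f ∉ P.thinRad t := fun _ h h' => h h'.2
  -- three pairwise independent directions with different radicals
  obtain ⟨t₁, ht₁, f, hf, hr⟩ := hind W W hWsat hWsat le_rfl hWtop hWbot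
  have hR₁ := hcard t₁ ht₁ fun h => hnot hf hr (h ▸ hf)
  obtain ⟨t₂, ht₂, f, hf, hr⟩ := hind W (P.thinRad t₁) hWsat (P.sat_thinRad t₁)
    (P.thinRad_le_thinMod t₁) hWtop (hne t₁ ht₁)
  have hf' := P.thinRad_le_thinMod t₁ hf
  have hR₂ := hcard t₂ ht₂ fun h => hnot hf' hr (h ▸ hf')
  have h12 : P.thinRad t₁ ≠ P.thinRad t₂ := fun h => hnot hf' hr (h ▸ hf)
  set E := W ⊔ AddSubgroup.zmultiples t₁ with hE
  have hEcard : Nat.card E = p * Nat.card W := P.card_sup_zmultiples hp hH ht₁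
  have hWE : W ≤ E := le_sup_left
  have ht₁E : t₁ ∈ E := AddSubgroup.mem_sup_right (AddSubgroup.mem_zmultiples t₁)
  have hEsat : P.Sat E := P.sat_of_le_thinMod hWE (htop ▸ le_top)
  have hEtop : E ≠ ⊤ := by
    intro h
    rw [h, AddSubgroup.card_top, hH, hO, ← pow_succ'] at hEcard
    exact absurd (Nat.pow_right_injective hp.two_le hEcard) (by norm_num)
  have htopE : Nat.card (⊤ : AddSubgroup H) = p * Nat.card E := by
    rw [AddSubgroup.card_top, hH, hEcard, hO]; ring
  obtain ⟨t₃, ht₃, f, hf, hr⟩ := hind E (P.thinRad t₂) hEsat (P.sat_thinRad t₂)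
    ((P.thinRad_le_thinMod t₂).trans hWE) hEtop (hne t₂ ht₂)
  have hf' := P.thinRad_le_thinMod t₂ hf
  have ht₃W : t₃ ∉ W := fun h => ht₃ (hWE h)
  have hR₃ := hcard t₃ ht₃W fun h => hnot hf' hr (h ▸ hf')
  have h23 : P.thinRad t₂ ≠ P.thinRad t₃ := fun h => hnot hf' hr (h ▸ hf)
  have ht₂E : t₂ ∉ E := by
    intro h
    obtain ⟨m, m', hm, hmt⟩ := P.exists_unit_zsmul_sub_mem hp hWE hEcard ht₁E ht₁ h ht₂
    apply h12
    rw [← P.thinRad_zsmul hm t₁, ← P.thinRad_add (t := m • t₁) hmt]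
    congr 1
    abel
  obtain ⟨β, β', hβ, hβt⟩ := P.exists_unit_zsmul_sub_mem hp le_top htopE
    (AddSubgroup.mem_top t₂) ht₂E (AddSubgroup.mem_top t₃) ht₃
  have ht₃β : t₃ - β • t₂ ∉ W := by
    intro h
    apply h23
    rw [← P.thinRad_zsmul hβ t₂, ← P.thinRad_add (t := β • t₂) h]
    congr 1
    abel
  obtain ⟨α, α', hα, hαt⟩ := P.exists_unit_zsmul_sub_mem hp hWE hEcard ht₁E ht₁ hβt ht₃β
  have hS₁ := P.thinRad_zsmul hα t₁
  have hS₂ := P.thinRad_zsmul hβ t₂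
  have hS₃ : P.thinRad (α • t₁ + β • t₂) = P.thinRad t₃ := by
    rw [← P.thinRad_add (t := α • t₁ + β • t₂) hαt]
    congr 1
    abel
  have h13 : P.thinRad t₁ ≠ P.thinRad t₃ := by
    intro h13
    apply h12
    symm
    refine AddSubgroup.eq_of_le_of_card_ge ?_ (by rw [hR₁, hR₂])
    rw [← hS₂]
    rintro k ⟨hk, h⟩
    obtain ⟨a, b, ha, hb, e⟩ := P.split (P.symm h) (u := α • t₁ + β • t₂) (v := -(α • t₁))
      (by abel)
    have h1 := hthin _ _ ha
    have h2 := hthin _ _ hb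
    have h3 := hthin _ _ (P.neg hb)
    rw [neg_neg, hS₁] at h3
    rw [hS₃, ← h13] at h1
    have := AddSubgroup.sub_mem _ h1 h3
    have e2 : k = a - (α • t₁ + β • t₂) - (-b - α • t₁) := by
      have : k = a + b - β • t₂ := by rw [← e]; abel
      rw [this]; abel
    rwa [e2]
  have hS₁W : α • t₁ ∉ W := fun h => ht₁ (by simpa [(hα t₁).1] using W.zsmul_mem h α')
  have hS₁E : α • t₁ ∈ E := E.zsmul_mem ht₁E α
  have hS₂E : β • t₂ ∉ E := fun h => ht₂E (by simpa [(hβ t₂).1] using E.zsmul_mem h β')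
  refine ⟨α • t₁, ?_, fun g hg h0 hx z => ?_⟩
  · have e : (P.thinRad (α • t₁) : Set H).ncard = p := by rw [hS₁]; exact hR₁
    refine le_trans ?_ e.le
    exact Set.ncard_le_ncard_of_injOn (fun y => y - α • t₁) (fun y hy => hthin _ _ hy)
      (fun a _ b _ h => by simpa using h) (Set.toFinite _)
  · set c : H → H := fun z => g z - z with hc
    have hcd : ∀ t z, c (z + t) - c z ∈ P.thinRad t := by
      intro t z
      have := hg (z + t) z
      rw [add_sub_cancel_left] at this
      have := hthin _ _ this
      have e : c (z + t) - c z = g (z + t) - g z - t := by simp only [hc]; abel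
      rwa [e]
    obtain ⟨j, hj⟩ := exists_zsmul_sub_mem hp le_top htopE (AddSubgroup.mem_top _) hS₂E
      (AddSubgroup.mem_top z)
    obtain ⟨i, hi⟩ := exists_zsmul_sub_mem hp hWE hEcard hS₁E hS₁W hj
    have hz := eq_zero_of_three_directions (c := c) (t₁ := α • t₁) (t₂ := β • t₂)
      (F₁ := P.thinRad t₁) (F₂ := P.thinRad t₂) (F₃ := P.thinRad t₃)
      (eq_zero_of_mem_of_mem hp hR₁ hR₂ h12) (eq_zero_of_mem_of_mem hp hR₁ hR₃ h13)
      (eq_zero_of_mem_of_mem hp hR₂ hR₃ h23) (fun z => hS₁ ▸ hcd _ z) (fun z => hS₂ ▸ hcd _ z)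
      (fun z => hS₃ ▸ hcd _ z) (by simp [hc, h0]) (by simp [hc, hx]) i j
    have hper := hg.thin_le_periods hi (i • α • t₁ + j • β • t₂)
    have e : i • α • t₁ + j • β • t₂ + (z - j • β • t₂ - i • α • t₁) = z := by abel
    rw [e] at hper
    rw [hper, sub_eq_zero.1 hz]
    abel

/-- The thin radical `W` has order `p²` and `H ⧸ W` is not thin. Then the basic sets outside an
`A`-subgroup `E ≥ W` of index `p` meet all the cosets of `W` in a coset of `E`, so they have the
same radical in `W`, which is trivial by indecomposability. -/
theorem exists_base_of_thinMod_ne_top (hO : Nat.card (P.thinMod ⊥) = p ^ 2)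
    (htop : P.thinMod (P.thinMod ⊥) ≠ ⊤) :
    ∃ x, {y | P.rel y x}.ncard ≤ p ∧ P.IsBase x := by
  set W := P.thinMod ⊥ with hW
  have hWsat : P.Sat W := P.sat_thinMod P.sat_bot
  have hWtop : W ≠ ⊤ := by
    intro h
    rw [h, AddSubgroup.card_top, hH] at hO
    exact absurd (Nat.pow_right_injective hp.two_le hO) (by norm_num)
  obtain ⟨E, hE, hWE, hEc⟩ := P.exists_sat_card hp hH hWsat hWtop
  have htopE : Nat.card (⊤ : AddSubgroup H) = p * Nat.card E := by
    rw [AddSubgroup.card_top, hH, hEc, hO]; ring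
  have hEW := P.le_thinMod_of_card hp hH hWsat hE hWE hEc
  have htE := P.le_thinMod_of_card hp hH hE P.sat_top le_top htopE
  have hEtop : E ≠ ⊤ := fun h => htop (top_le_iff.1 (h ▸ hEW))
  have hout : ∀ x, x ∉ E → x ∉ P.thinMod W := by
    intro x hx hxW
    refine htop (eq_of_lt_of_le_of_card hp (lt_of_le_of_ne hEW ?_) le_top htopE)
    rintro h
    exact hx (h ▸ hxW)
  obtain ⟨x, hx⟩ : ∃ x, x ∉ E := by
    by_contra! h
    exact hEtop ((AddSubgroup.eq_top_iff' E).2 h)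
  have hnear : ∀ y, y - x ∈ E → P.near W y x := fun y hy =>
    near_of_notMem_thinMod hp hH hWsat hWE hEc (htE trivial) (hout x hx) hy
  have hR : ∀ y, y - x ∈ E → P.thinRad y = P.thinRad x := by
    intro y hy
    obtain ⟨k, hk, h⟩ := hnear y hy
    rw [← P.thinRad_congr h, P.thinRad_add hk]
  have hR0 : P.thinRad x = ⊥ := by
    by_contra h0
    obtain ⟨t, ht, f, hf, hrel⟩ := hind E (P.thinRad x) hE (P.sat_thinRad x)
      ((P.thinRad_le_thinMod x).trans hWE) hEtop h0
    obtain ⟨m, m', hm, hmt⟩ := P.exists_unit_zsmul_sub_mem hp le_top htopE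
      (AddSubgroup.mem_top x) hx (AddSubgroup.mem_top t) ht
    have h1 : m' • t - x ∈ E := by
      have := E.zsmul_mem hmt m'
      rwa [smul_sub, (hm _).1] at this
    have h2 := hR _ h1
    rw [P.thinRad_zsmul (fun y => (hm y).symm)] at h2
    rw [← h2] at hf
    exact hrel hf.2
  have hsec : ∀ a b, P.rel a x → P.rel b x → a - b ∈ W → a = b := by
    intro a b ha hb hab
    have : a - b ∈ P.thinRad b := ⟨hab, by simpa using P.trans ha (P.symm hb)⟩
    rw [P.thinRad_congr hb, hR0, AddSubgroup.mem_bot, sub_eq_zero] at this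
    exact this
  refine ⟨x, ?_, fun g hg h0 hgx z => ?_⟩
  · have := card_mul_le hWE (htE trivial) hsec
    rw [hEc] at this
    exact Nat.le_of_mul_le_mul_right this Nat.card_pos
  · refine hind.eq_of_fixed hp hH hE (by simpa using htopE) hg (x := x) (fun y hy => ?_) z
    obtain ⟨k, hk, h⟩ := hnear y hy
    have h1 := hg.eq_of_section h0 (htE trivial) hEW hsec hgx h
    rw [hg.thin_le_periods hk y] at h1
    simpa using h1

/-- If the thin radical has index at most `p`, only translations are automorphisms. -/
theorem isBase_zero_of_le {E : AddSubgroup H} (hE : Nat.card E = p ^ 3)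
    (hEO : E ≤ P.thinMod ⊥) : P.IsBase 0 := by
  intro g hg h0 _ z
  refine hind.eq_of_fixed hp hH (P.sat_of_le_thinMod bot_le hEO) (by rw [hH, hE]; ring) hg
    (x := 0) (fun y hy => ?_) z
  have := hg.thin_le_periods (hEO (by simpa using hy)) 0
  simpa [h0] using this

end cases

end PSchurPartition
end SchurRing

/-! ### Base points: thin radical of order `p`, small basic sets -/

namespace SchurRing
namespace PSchurPartition

variable {p : ℕ} {H : Type*} [AddCommGroup H] [Finite H] (P : PSchurPartition p H)

section cases
variable {P}

/-- An element of `U \ L`, where `U` is thin modulo `L`, does not lie in a section over `L`. -/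
theorem notMem_of_isSection {U : AddSubgroup H} (hU : U ≤ P.thinMod (P.thinMod ⊥)) {t : H}
    (ht : P.IsSection (P.thinMod ⊥) t) (htL : t ∉ P.thinMod ⊥) : t ∉ U := by
  intro htU
  refine htL fun x hx => ?_
  have := ht.eq_of_rel le_rfl hx (P.refl t) (hU htU x hx)
  simp [this]

theorem exists_mem_ne_zero (hp : p.Prime) (hO : Nat.card (P.thinMod ⊥) = p) :
    ∃ l ∈ P.thinMod ⊥, l ≠ 0 := by
  by_contra! h
  rw [(AddSubgroup.eq_bot_iff_forall _).2 h, AddSubgroup.card_bot] at hO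
  exact hp.one_lt.ne hO

variable (hp : p.Prime) (hH : Nat.card H = p ^ 4) (hO : Nat.card (P.thinMod ⊥) = p)
include hp hH hO

/-- If the thin radical `L` has order `p`, it is contained in all nontrivial `A`-subgroups. -/
theorem le_of_sat {F : AddSubgroup H} (hF : P.Sat F) (h0 : F ≠ ⊥) : P.thinMod ⊥ ≤ F := by
  obtain ⟨y, hyF, hy0, hy⟩ := P.exists_mem_thinMod hp hH P.sat_bot hF (bot_lt_iff_ne_bot.2 h0)
  intro x hx
  obtain ⟨m, hm⟩ := exists_zsmul_sub_mem hp (K := ⊥) bot_le (by simpa using hO) hy hy0 hx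
  rw [AddSubgroup.mem_bot, sub_eq_zero] at hm
  rw [hm]
  exact F.zsmul_mem hyF m

/-- If the thin radical has order `p`, a section over it has trivial radical. -/
theorem eq_zero_of_mem_radical {t w : H} (ht : P.IsSection (P.thinMod ⊥) t)
    (hw : ∀ y, P.rel y t → P.rel (y + w) t) : w = 0 := by
  by_contra hne
  have hw' : w ∈ P.rowStab ⊤ t := ⟨trivial, fun d _ h => hw _ h⟩
  have hle := le_of_sat hp hH hO (P.sat_rowStab_top t) (by
    intro h
    rw [h, AddSubgroup.mem_bot] at hw'
    exact hne hw')
  obtain ⟨l, hl, hl0⟩ := exists_mem_ne_zero hp hO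
  have := (hle hl).2 0 trivial (by simpa using P.refl t)
  rw [add_zero] at this
  exact hl0 (ht l hl this)

/-- The case of an `A`-subgroup `W` of order `p²` with thin quotient. An automorphism that fixes
`0` and a point outside `W` whose basic set is a section commutes with the translations by `W`, and
then with the translations by all sections. -/
theorem exists_base_of_thin_quotient (hind : P.Indecomposable) {W : AddSubgroup H}
    (hLW : P.thinMod ⊥ ≤ W) (hWL : W ≤ P.thinMod (P.thinMod ⊥)) (hW : Nat.card W = p ^ 2)
    (htop : P.thinMod W = ⊤) :
    ∃ x, {y | P.rel y x}.ncard ≤ p ∧ P.IsBase x := by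
  set L := P.thinMod ⊥ with hLdef
  have hWc : Nat.card W = p * Nat.card L := by rw [hW, hO, pow_two]
  have hthin : ∀ x y, P.rel y x → y - x ∈ W := fun x y h =>
    (htop ▸ AddSubgroup.mem_top x : x ∈ P.thinMod W) y h
  have hcl := hind.closure_isSection hp (L := L) le_rfl hO
  obtain ⟨t, ht, htW⟩ : ∃ t, P.IsSection L t ∧ t ∉ W := by
    by_contra! h
    have : AddSubgroup.closure {t | P.IsSection L t} ≤ W := (AddSubgroup.closure_le W).2 h
    rw [hcl, top_le_iff] at this
    rw [this, AddSubgroup.card_top, hH] at hW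
    exact absurd (Nat.pow_right_injective hp.two_le hW) (by norm_num)
  refine ⟨t, ?_, fun g hg h0 hgt z => ?_⟩
  · have := card_mul_le hLW (hthin t) (fun a b ha hb hab => ht.eq_of_rel le_rfl ha hb hab)
    rw [hWc] at this
    exact Nat.le_of_mul_le_mul_right this Nat.card_pos
  · -- there is a point of the basic set of `t` other than `t`
    have htL : t ∉ L := fun h => htW (hLW h)
    obtain ⟨v, hv, hvt⟩ : ∃ v, P.rel v t ∧ v - t ∉ (⊥ : AddSubgroup H) := by
      by_contra! h
      exact htL h
    have hu : v - t ∈ W := hthin t v hv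
    have huL : v - t ∉ L := by
      intro h
      apply hvt
      rw [ht.eq_of_rel le_rfl hv (P.refl t) h]
      simp
    have hadd : ∀ u ∈ W, ∀ z, g (z + u) - g z = g u := by
      intro u hu z
      have key : ∀ w, g (w + z + u) - g (w + z) = g (w + u) - g w := by
        refine AddSubgroup.closure_induction
          (p := fun z _ => ∀ w, g (w + z + u) - g (w + z) = g (w + u) - g w)
          ?_ ?_ ?_ ?_ (hcl ▸ AddSubgroup.mem_top z)
        · intro s hs w
          exact hg.add_sub_eq le_rfl hWL hu (by simpa using hs)
        · intro w; simp
        · intro a b _ _ ha hb w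
          rw [← add_assoc, hb, ha]
        · intro a _ ha w
          have := ha (w + -a)
          rw [neg_add_cancel_right] at this
          exact this.symm
      simpa [h0] using key 0
    have hgu : g (v - t) = v - t := by
      have h1 := hadd _ hu t
      rw [add_sub_cancel, hgt] at h1
      have h2 : g v = v := ht.eq_of_rel le_rfl (P.trans (hg.rel_self h0 v) hv) hv (by
        have := hg.sub_sub_mem (hWL hu)
        rw [hgt] at this
        simpa using this)
      rw [← h1, h2]
    have hper : W ≤ periods g := by
      have hlt : L < W ⊓ periods g := by
        refine lt_of_le_of_ne (le_inf hLW hg.thin_le_periods) fun h => huL ?_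
        rw [h]
        refine ⟨hu, fun z => ?_⟩
        have := hadd _ hu z
        rw [hgu, sub_eq_iff_eq_add] at this
        rw [this, add_comm]
      exact inf_eq_left.1 (eq_of_lt_of_le_of_card hp hlt inf_le_left hWc)
    have hperS : ∀ s, P.IsSection L s → s ∈ periods g := by
      intro s hs z
      have hd : g (z + s) - g z - s = 0 := by
        refine eq_zero_of_mem_radical hp hH hO hs fun y hy => ?_
        have h1 := hper (hthin s y hy) (z + s)
        have e : z + s + (y - s) = z + y := by abel
        rw [e] at h1
        have h2 := hg (z + y) z
        rw [add_sub_cancel_left] at h2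
        have e2 : y + (g (z + s) - g z - s) = g (z + y) - g z := by rw [h1]; abel
        rw [e2]
        exact P.trans h2 hy
      rw [sub_sub, sub_eq_zero] at hd
      exact hd
    have hz : z ∈ periods g := by
      have : AddSubgroup.closure {t | P.IsSection L t} ≤ periods g :=
        (AddSubgroup.closure_le _).2 hperS
      exact this (hcl ▸ AddSubgroup.mem_top z)
    have := hz 0
    simpa [h0] using this

/-- The case of a basic set of size at most `p` outside an `A`-subgroup `E` of index `p`. An
automorphism that fixes `0` and a point of this basic set is trivial modulo the thin radical `L`,
unless the outer radical of `E` modulo `L` is larger than `L`; the quotient by it is then thin. -/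
theorem exists_base_of_card_le (hind : P.Indecomposable) {U E : AddSubgroup H} (hU : P.Sat U)
    (hE : P.Sat E) (hLU : P.thinMod ⊥ ≤ U) (hUE : U ≤ E)
    (hUc : Nat.card U = p * Nat.card (P.thinMod ⊥)) (hEc : Nat.card E = p * Nat.card U) {x : H}
    (hxE : x ∉ E) (hcx : {y | P.rel y x}.ncard ≤ p) :
    ∃ x, {y | P.rel y x}.ncard ≤ p ∧ P.IsBase x := by
  set L := P.thinMod ⊥ with hLdef
  have hLsat : P.Sat L := P.sat_thinMod P.sat_bot
  have htopE : Nat.card (⊤ : AddSubgroup H) = p * Nat.card E := by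
    rw [AddSubgroup.card_top, hH, hEc, hUc, hO]; ring
  have hUL := P.le_thinMod_of_card hp hH hLsat hU hLU hUc
  have hEU := P.le_thinMod_of_card hp hH hU hE hUE hEc
  have htE := P.le_thinMod_of_card hp hH hE P.sat_top le_top htopE
  by_cases hxU : x ∈ P.thinMod U
  · refine exists_base_of_thin_quotient hp hH hO hind hLU hUL (by rw [hUc, hO, pow_two]) ?_
    refine eq_of_lt_of_le_of_card hp (lt_of_le_of_ne hEU ?_) le_top htopE
    intro h
    exact hxE (h ▸ hxU)
  have hnear : ∀ y, y - x ∈ E → P.near U y x := fun y hy =>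
    near_of_notMem_thinMod hp hH hU hUE hEc (htE trivial) hxU hy
  -- the basic set of `x` is a section over `U`, as it has at most `p` elements and meets all the
  -- cosets of `U` in `x + E`
  have hsec : ∀ a b, P.rel a x → P.rel b x → a - b ∈ U → a = b := by
    have himg : (E : Set H) ⊆
        (fun q : H × H => q.1 - q.2 - x) '' ({y | P.rel y x} ×ˢ (U : Set H)) := by
      intro e he
      obtain ⟨k, hk, h⟩ := hnear (x + e) (by simpa using he)
      exact ⟨(x + e + k, k), ⟨h, hk⟩, by simp only []; abel⟩
    have h1 : ({y | P.rel y x} ×ˢ (U : Set H)).ncard ≤ (E : Set H).ncard := by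
      rw [Set.ncard_prod]
      have e1 : (U : Set H).ncard = Nat.card U := rfl
      have e2 : (E : Set H).ncard = Nat.card E := rfl
      rw [e1, e2, hEc]
      exact Nat.mul_le_mul_right _ hcx
    have h2 := (Set.ncard_le_ncard himg).trans (Set.ncard_image_le (Set.toFinite _))
    have hinj := Set.injOn_of_ncard_image_eq (f := fun q : H × H => q.1 - q.2 - x)
      (s := {y | P.rel y x} ×ˢ (U : Set H))
      (le_antisymm (Set.ncard_image_le (Set.toFinite _))
        (h1.trans (Set.ncard_le_ncard himg))) (Set.toFinite _)
    intro a b ha hb hab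
    have := @hinj (a, a - b) ⟨ha, hab⟩ (b, 0) ⟨hb, U.zero_mem⟩ (by simp)
    exact congrArg Prod.fst this
  by_cases hRad : P.outerRad hLsat (le_top : E ≤ ⊤) = L
  · refine ⟨x, hcx, fun g hg h0 hgx z => ?_⟩
    have hcoset : ∀ y, y - x ∈ E → g y - y ∈ L := by
      intro y hy
      obtain ⟨k, hk, h⟩ := hnear y hy
      have h1 := hg.eq_of_section h0 (htE trivial) hEU hsec hgx h
      have h2 := hg.sub_sub_mem (x := y + k) (y := y) (K := L) (by simpa using hUL hk)
      rw [h1] at h2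
      have e : y + k - g y - (y + k - y) = -(g y - y) := by abel
      rw [e] at h2
      simpa using L.neg_mem h2
    refine hind.eq_of_sub_mem hp le_rfl hO hg h0 (fun z => ?_) z
    by_cases hz : z - x ∈ E
    · exact hcoset z hz
    · change g z - z ∈ L
      rw [← hRad]
      exact hg.sub_mem_outerRad hp hH hLsat hE P.sat_top (hLU.trans hUE) le_top htopE hcoset
        trivial hz
  · set R := P.outerRad hLsat (le_top : E ≤ ⊤) with hR
    have hLR : L ≤ R := le_outerRad (hLU.trans hUE)
    have hRsat : P.Sat R := sat_outerRad hE P.sat_top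
    -- the basic set of `x` modulo `L` contains a coset of `R`, so `R` has order `p ^ 2`
    have hcard : {y | P.near L y x}.ncard ≤ p ^ 2 := by
      have hsub : {y | P.near L y x} ⊆
          (fun q : H × H => q.1 - q.2) '' ({y | P.rel y x} ×ˢ (L : Set H)) := by
        rintro y ⟨k, hk, h⟩
        exact ⟨(y + k, k), ⟨h, hk⟩, by simp⟩
      refine (Set.ncard_le_ncard hsub).trans ((Set.ncard_image_le (Set.toFinite _)).trans ?_)
      rw [Set.ncard_prod, pow_two]
      exact Nat.mul_le_mul hcx hO.le
    have hsub : (fun k => x + k) '' (R : Set H) ⊆ {y | P.near L y x} := by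
      rintro _ ⟨k, hk, rfl⟩
      exact (mem_outerRad.1 hk).2 x trivial hxE
    have hRimg : ((fun k => x + k) '' (R : Set H)).ncard = Nat.card R := by
      rw [Set.ncard_image_of_injective _ (add_right_injective x)]; rfl
    have hRle : Nat.card R ≤ p ^ 2 := by
      rw [← hRimg]
      exact (Set.ncard_le_ncard hsub).trans hcard
    have hRc : Nat.card R = p ^ 2 := by
      obtain ⟨i, -, hi⟩ := card_subgroup hp hH R
      rw [hi] at hRle ⊢
      have h2 := (Nat.pow_le_pow_iff_right hp.one_lt).1 hRle
      have h3 : 1 < i := by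
        by_contra! h
        refine hRad (AddSubgroup.eq_of_le_of_card_ge hLR ?_).symm
        rw [hi, hO]
        exact (Nat.pow_le_pow_right hp.pos h).trans (pow_one p).le
      rw [le_antisymm h2 h3]
    have heq := Set.eq_of_subset_of_ncard_le hsub (by rw [hRimg, hRc]; exact hcard)
    have hRc' : Nat.card R = p * Nat.card L := by rw [hRc, hO, pow_two]
    have hxR : x ∈ P.thinMod R := by
      intro y hy
      have : y ∈ {y | P.near L y x} := P.near_of_rel L hy
      rw [← heq] at this
      obtain ⟨k, hk, rfl⟩ := this
      simpa using hk
    refine exists_base_of_thin_quotient hp hH hO hind hLR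
      (P.le_thinMod_of_card hp hH hLsat hRsat hLR hRc') hRc ?_
    have hEle : E ≤ P.thinMod R := by
      intro e he
      obtain ⟨k, hk, h⟩ := hnear (x + e) (by simpa using he)
      have h1 : x + e + k ∈ P.thinMod R := P.sat_thinMod hRsat _ _ (P.symm h) hxR
      have h2 : k ∈ P.thinMod R := P.thinMod_mono hLR (hUL hk)
      have e1 : e = x + e + k - x - k := by abel
      rw [e1]
      exact AddSubgroup.sub_mem _ (AddSubgroup.sub_mem _ h1 hxR) h2
    refine eq_of_lt_of_le_of_card hp (lt_of_le_of_ne hEle ?_) le_top htopE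
    intro h
    exact hxE (h ▸ hxR)

/-- The case of a basic set in `E \ L` which is a section over the thin radical `L`, where `E` is an
`A`-subgroup of index `p`. An automorphism that fixes `0` and a point `b` of this basic set fixes
`b + U`, then `E` and then `H` pointwise, because the outer radicals are trivial. -/
theorem exists_base_of_isSection_mem (hind : P.Indecomposable) {U E : AddSubgroup H}
    (hU : P.Sat U) (hE : P.Sat E) (hLU : P.thinMod ⊥ ≤ U) (hUE : U ≤ E)
    (hUc : Nat.card U = p * Nat.card (P.thinMod ⊥)) (hEc : Nat.card E = p * Nat.card U) {b : H}
    (hbE : b ∈ E) (hbL : b ∉ P.thinMod ⊥) (hb : P.IsSection (P.thinMod ⊥) b) :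
    ∃ x, {y | P.rel y x}.ncard ≤ p ∧ P.IsBase x := by
  set L := P.thinMod ⊥ with hLdef
  have hLsat : P.Sat L := P.sat_thinMod P.sat_bot
  have hUL := P.le_thinMod_of_card hp hH hLsat hU hLU hUc
  have hEU := P.le_thinMod_of_card hp hH hU hE hUE hEc
  have hbU : b ∉ U := notMem_of_isSection hUL hb hbL
  have hbL' : b ∉ P.thinMod L := notMem_of_isSection le_rfl hb hbL
  have hsec : ∀ a c, P.rel a b → P.rel c b → a - c ∈ L → a = c := fun a c ha hc hac =>
    hb.eq_of_rel le_rfl ha hc hac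
  refine ⟨b, ?_, fun g hg h0 hgb z => ?_⟩
  · have := card_mul_le hLU (hEU hbE) hsec
    rw [hUc] at this
    exact Nat.le_of_mul_le_mul_right this Nat.card_pos
  · have hcoset : ∀ y, y - b ∈ U → g y = y := by
      intro y hy
      obtain ⟨k, hk, h⟩ := near_of_notMem_thinMod hp hH hLsat hLU hUc (hEU hbE) hbL' hy
      have h1 := hg.eq_of_section h0 (hEU hbE) hUL hsec hgb h
      rw [hg.thin_le_periods hk y] at h1
      simpa using h1
    have hRad : P.outerRad P.sat_bot hUE = ⊥ := by
      by_contra hne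
      have hle := le_of_sat hp hH hO (sat_outerRad hU hE) hne
      obtain ⟨l, hl, hl0⟩ := exists_mem_ne_zero hp hO
      exact hl0 (hb l hl (P.near_bot.1 ((mem_outerRad.1 (hle hl)).2 b hbE hbU)))
    have hfix : ∀ y ∈ E, g y = y := by
      intro y hy
      by_cases hyb : y - b ∈ U
      · exact hcoset y hyb
      · have := hg.sub_mem_outerRad hp hH P.sat_bot hU hE bot_le hUE hEc (x := b)
          (fun y hy => by simp [hcoset y hy]) (E.sub_mem hy hbE) hyb
        rw [hRad, AddSubgroup.mem_bot, sub_eq_zero] at this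
        exact this
    exact hind.eq_of_fixed hp hH hE (by rw [hH, hEc, hUc, hO]; ring) hg (x := 0)
      (fun y hy => hfix y (by simpa using hy)) z

end cases

end PSchurPartition
end SchurRing

/-! ### Base points: thin radical of order `p`, basic sets of size `p ^ 2` -/

namespace SchurRing
namespace PSchurPartition

variable {p : ℕ} {H : Type*} [AddCommGroup H] [Finite H] {P : PSchurPartition p H}

section rowStab
variable {U : AddSubgroup H}

theorem rowStab_le_add_of_thin {t k : H} (hk : k ∈ P.thinMod ⊥) :
    P.rowStab U t ≤ P.rowStab U (t + k) := by
  rintro s ⟨hs, h'⟩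
  refine ⟨hs, fun d hd hr => ?_⟩
  have h1 := P.rel_add_of_thin (AddSubgroup.neg_mem _ hk) hr
  have e : t + k + d + -k = t + d := by abel
  rw [e, add_neg_cancel_right] at h1
  have h2 := P.rel_add_of_thin hk (h' d hd h1)
  have e : t + d + s + k = t + k + d + s := by abel
  rwa [e] at h2

theorem rowStab_zsmul {m m' : ℤ} (hm : ∀ x : H, m' • m • x = x ∧ m • m' • x = x) (t : H) :
    P.rowStab U (m • t) = P.rowStab U t := by
  have key : ∀ {m m' : ℤ}, (∀ x : H, m' • m • x = x ∧ m • m' • x = x) → ∀ (t : H),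
      ∀ s ∈ P.rowStab U t, m • s ∈ P.rowStab U (m • t) := by
    rintro m m' hm t s ⟨hs, h⟩
    refine ⟨U.zsmul_mem hs m, fun d hd hr => ?_⟩
    have h1 := P.zsmul m' hr
    rw [smul_add, (hm _).1] at h1
    have h2 := P.zsmul m (h _ (U.zsmul_mem hd m') h1)
    rwa [smul_add, smul_add, (hm _).2] at h2
  ext s
  constructor
  · intro h
    have h1 := key (fun x => (hm x).symm) _ s h
    rw [(hm t).1] at h1
    simpa [(hm s).2] using AddSubgroup.zsmul_mem _ h1 m
  · intro h
    have h1 := key hm t _ (AddSubgroup.zsmul_mem _ h m')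
    rwa [(hm s).2] at h1

end rowStab

/-- A planarity property. Suppose that the basic set of `t` is a section over `L` with at most `p²`
elements, and that the basic set of `w` contains `w + L`. Then `w` is a difference of two elements
of the basic set of `t` in at most `p` ways: all `p` elements of `w + L` are differences equally
often, and no element of the basic set of `t` is the first term for two of them. -/
theorem card_differences_le (hp : p.Prime) {L : AddSubgroup H} {t : H} (hO : Nat.card L = p)
    (hL : L ≤ P.thinMod ⊥) (hsec : P.IsSection L t) (hcard : {y | P.rel y t}.ncard ≤ p ^ 2) {w : H}
    (hw : ∀ k ∈ L, P.rel (w + k) w) :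
    {u | P.rel u t ∧ P.rel (u - w) t}.ncard ≤ p := by
  classical
  have := Fintype.ofFinite H
  have hcount : ∀ k ∈ L, {u | P.rel u t ∧ P.rel (u - (w + k)) t}.ncard
      = {u | P.rel u t ∧ P.rel (u - w) t}.ncard := by
    intro k hk
    have key := P.count (S := {y | P.rel y t}) (S' := {y | P.rel y (-t)})
      (fun x y hxy hx => P.trans (P.symm hxy) hx) (fun x y hxy hx => P.trans (P.symm hxy) hx)
      (hw k hk)
    have e : ∀ x : H, {u | u ∈ {y | P.rel y t} ∧ x - u ∈ {y | P.rel y (-t)}}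
        = {u | P.rel u t ∧ P.rel (u - x) t} := by
      intro x
      ext u
      refine and_congr_right fun _ => ⟨fun h => ?_, fun h => ?_⟩
      · simpa using P.neg h
      · simpa using P.neg h
    rwa [e, e] at key
  set N := {u | P.rel u t ∧ P.rel (u - w) t}.ncard with hN
  have h1 : p * N ≤ {y | P.rel y t}.ncard := by
    have hdisj : ((Finset.univ : Finset L) : Set L).PairwiseDisjoint
        (fun k => {u | P.rel u t ∧ P.rel (u - (w + k)) t}.toFinset) := by
      intro k _ k' _ hkk
      refine Finset.disjoint_left.2 fun u hu hu' => hkk ?_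
      rw [Set.mem_toFinset] at hu hu'
      have := hsec.eq_of_rel hL hu.2 hu'.2 (by
        have e : u - (w + k) - (u - (w + k')) = (k' : H) - k := by abel
        rw [e]
        exact L.sub_mem k'.2 k.2)
      ext
      simpa using this
    have hc := Finset.card_biUnion hdisj
    have hsum : ∑ k : L, ({u | P.rel u t ∧ P.rel (u - (w + (k : H))) t}.toFinset).card = p * N := by
      rw [Finset.sum_congr rfl (fun k _ => by
        rw [← Set.ncard_eq_toFinset_card', hcount k k.2]), Finset.sum_const, Finset.card_univ,
        ← Nat.card_eq_fintype_card, hO, smul_eq_mul]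
    rw [hsum] at hc
    rw [← hc, Set.ncard_eq_toFinset_card']
    refine Finset.card_le_card fun u hu => ?_
    simp only [Finset.mem_biUnion, Set.mem_toFinset] at hu ⊢
    obtain ⟨k, -, hu⟩ := hu
    exact hu.1
  have h2 := h1.trans hcard
  rw [pow_two] at h2
  exact Nat.le_of_mul_le_mul_left h2 hp.pos

section cases
variable (hp : p.Prime) (hodd : Odd p) (hH : Nat.card H = p ^ 4)
  (hO : Nat.card (P.thinMod ⊥) = p)

include hp hO in
/-- Different cosets of `U` in `t + E` have independent stabilizers in `U`. -/
theorem rowStab_disjoint {U E : AddSubgroup H} (hLU : P.thinMod ⊥ ≤ U) (hUE : U ≤ E)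
    (hsec : ∀ t, t ∉ E → P.IsSection (P.thinMod ⊥) t)
    (hcard : ∀ t, t ∉ E → {y | P.rel y t}.ncard ≤ p ^ 2)
    (hnear : ∀ t, t ∉ E → ∀ y, y - t ∈ E → P.near (P.thinMod ⊥) y t)
    (hEL : ∀ w ∈ E, w ∉ P.thinMod ⊥ → ∀ k ∈ P.thinMod ⊥, P.rel (w + k) w) {t t' : H}
    (ht : t ∉ E) (htt : t' - t ∈ E) (httU : t' - t ∉ U) :
    ∀ s ∈ P.rowStab U t, s ∈ P.rowStab U t' → s = 0 := by
  intro s hs hs'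
  by_contra hs0
  set L := P.thinMod ⊥ with hL
  have hsL : s ∉ L := by
    intro h
    have := hs.2 0 U.zero_mem (by simpa using P.refl t)
    rw [add_zero] at this
    exact hs0 (hsec t ht s h this)
  obtain ⟨k, hk, hr⟩ := hnear t ht t' htt
  have hs'' := rowStab_le_add_of_thin hk hs'
  set a := t' + k with ha
  have haU : a - t ∉ U := by
    intro h
    apply httU
    have e : t' - t = a - t - k := by rw [ha]; abel
    rw [e]
    exact U.sub_mem h (hLU hk)
  have hN := card_differences_le hp hO le_rfl (hsec t ht) (hcard t ht)
    (hEL s (hUE hs.1) hsL)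
  -- the `p` elements of `t + ⟨s⟩` are all the solutions
  have hmem : ∀ b, P.rel b t → s ∈ P.rowStab U b → ∀ z ∈ AddSubgroup.zmultiples s,
      P.rel (b + z) t := by
    intro b hb hsb z hz
    have hz' : z ∈ P.rowStab U b := (AddSubgroup.zmultiples_le_of_mem hsb) hz
    have := hz'.2 0 U.zero_mem (by simpa using P.refl b)
    rw [add_zero] at this
    exact P.trans this hb
  have hsub : ∀ b, P.rel b t → s ∈ P.rowStab U b →
      (fun z => b + z) '' (AddSubgroup.zmultiples s : Set H) ⊆
        {u | P.rel u t ∧ P.rel (u - s) t} := by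
    rintro b hb hsb _ ⟨z, hz, rfl⟩
    refine ⟨hmem b hb hsb z hz, ?_⟩
    have e : b + z - s = b + (z - s) := by abel
    simp only [e]
    exact hmem b hb hsb _ (AddSubgroup.sub_mem _ hz (AddSubgroup.mem_zmultiples s))
  have hord : ((fun z => t + z) '' (AddSubgroup.zmultiples s : Set H)).ncard = p := by
    rw [Set.ncard_image_of_injective _ (add_right_injective t)]
    have e : (AddSubgroup.zmultiples s : Set H).ncard = Nat.card (AddSubgroup.zmultiples s) := rfl
    have : Fact p.Prime := ⟨hp⟩
    rw [e, Nat.card_zmultiples, addOrderOf_eq_prime (P.nsmul_eq_zero s) hs0]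
  have heq := Set.eq_of_subset_of_ncard_le (hsub t (P.refl t) hs) (by rw [hord]; exact hN)
  have hamem : a ∈ {u | P.rel u t ∧ P.rel (u - s) t} :=
    hsub a hr hs'' ⟨0, AddSubgroup.zero_mem _, by simp⟩
  rw [← heq] at hamem
  obtain ⟨z, hz, e⟩ := hamem
  apply haU
  rw [← e]
  have : z ∈ U := (AddSubgroup.zmultiples_le_of_mem hs.1) hz
  simpa using this

include hp hodd hH hO

/-- The case in which the basic sets outside `E` are sections over the thin radical `L` meeting all
cosets of `L` in a coset of `E`, while the basic sets in `E \ L` are unions of cosets of `L`. An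
automorphism `g` fixing `0` and `x ∉ E` commutes with the translations by `U`, and its displacement
`c z = g z - z` changes along `t ∉ E` by elements of `rowStab U t`. These subgroups are independent
for different cosets of `U`, which forces `c = 0`. -/
theorem isBase_of_card_sq (hind : P.Indecomposable) {U E : AddSubgroup H}
    (hU : P.Sat U) (hE : P.Sat E) (hLU : P.thinMod ⊥ ≤ U) (hUE : U ≤ E)
    (hUc : Nat.card U = p * Nat.card (P.thinMod ⊥)) (hEc : Nat.card E = p * Nat.card U)
    (hsec : ∀ t, t ∉ E → P.IsSection (P.thinMod ⊥) t)
    (hcard : ∀ t, t ∉ E → {y | P.rel y t}.ncard ≤ p ^ 2)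
    (hnear : ∀ t, t ∉ E → ∀ y, y - t ∈ E → P.near (P.thinMod ⊥) y t)
    (hEL : ∀ w ∈ E, w ∉ P.thinMod ⊥ → ∀ k ∈ P.thinMod ⊥, P.rel (w + k) w) {x : H}
    (hxE : x ∉ E) : P.IsBase x := by
  set L := P.thinMod ⊥ with hLdef
  have hLsat : P.Sat L := P.sat_thinMod P.sat_bot
  have htopE : Nat.card (⊤ : AddSubgroup H) = p * Nat.card E := by
    rw [AddSubgroup.card_top, hH, hEc, hUc, hO]; ring
  have hUL := P.le_thinMod_of_card hp hH hLsat hU hLU hUc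
  have hEU := P.le_thinMod_of_card hp hH hU hE hUE hEc
  have htE := P.le_thinMod_of_card hp hH hE P.sat_top le_top htopE
  obtain ⟨τ, hτ⟩ : ∃ τ : ℤ, ∀ x : H, τ • (2 : ℤ) • x = x ∧ (2 : ℤ) • τ • x = x := by
    refine P.exists_inv hp fun h => ?_
    have h2 : p ∣ 2 := by exact_mod_cast h
    rw [(Nat.prime_dvd_prime_iff_eq hp Nat.prime_two).1 h2] at hodd
    exact absurd hodd (by decide)
  have two_mem : ∀ (K : AddSubgroup H) (y : H), (2 : ℤ) • y ∈ K → y ∈ K := by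
    intro K y h
    simpa [(hτ y).1] using K.zsmul_mem h τ
  have hdisj : ∀ {t t' : H}, t ∉ E → t' - t ∈ E → t' - t ∉ U →
      ∀ s ∈ P.rowStab U t, s ∈ P.rowStab U t' → s = 0 := fun ht htt httU =>
    rowStab_disjoint hp hO hLU hUE hsec hcard hnear hEL ht htt httU
  have hxU : ∀ {d}, d ∈ E → x + d ∉ E := fun hd h => hxE ((E.add_mem_cancel_right hd).1 h)
  intro g hg h0 hgx z
  -- `g` acts on the cosets of `U` in a uniform way
  have hadd : ∀ u ∈ U, ∀ z, g (z + u) - g z = g u := by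
    intro u hu z
    have h1 : g (x + u) - g x = g u := by
      have := hg.add_sub_eq le_rfl hUL hu (z := 0) (z' := x) (hsec _ (by simpa using hxE))
      simpa [h0] using this
    by_cases hz : z ∈ E
    · rw [← h1]
      exact (hg.add_sub_eq le_rfl hUL hu
        (hsec _ fun h => hxE (by simpa using E.add_mem h hz))).symm
    · have := hg.add_sub_eq le_rfl hUL hu (z := 0) (z' := z) (hsec _ (by simpa using hz))
      simpa [h0] using this
  have hper : U ≤ periods g := by
    intro u hu z
    obtain ⟨k, hk, hr⟩ := hnear x hxE (x + u) (by simpa using hUE hu)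
    rw [add_assoc] at hr
    have huk := U.add_mem hu (hLU hk)
    have h1 := hadd _ huk x
    rw [hgx] at h1
    have h2 : g (x + (u + k)) = x + (u + k) := by
      refine (hsec x hxE).eq_of_rel le_rfl (P.trans (hg.rel_self h0 _) hr) hr ?_
      have := hg.sub_sub_mem (x := x + (u + k)) (y := x) (K := L) (by simpa using hUL huk)
      rwa [hgx, add_sub_cancel_left, sub_sub] at this
    rw [h2, add_sub_cancel_left] at h1
    have h3 : g u = u := by
      have := hg.thin_le_periods hk u
      rw [← h1] at this
      exact (add_right_cancel this).symm
    have := hadd u hu z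
    rw [h3, sub_eq_iff_eq_add] at this
    rw [this, add_comm]
  set c : H → H := fun z => g z - z with hc
  have hc0 : c 0 = 0 := by simp [hc, h0]
  have hcx : c x = 0 := by simp [hc, hgx]
  have hcper : ∀ z, ∀ u ∈ U, c (z + u) = c z := by
    intro z u hu
    have := hper hu z
    simp only [hc, this]; abel
  have hcE : ∀ z ∈ E, c z ∈ U := by
    intro z hz
    have := hg.sub_sub_mem (x := z) (y := 0) (K := U) (by simpa using hEU hz)
    simpa [h0] using this
  have hcxE : ∀ z ∈ E, c (x + z) ∈ U := by
    intro z hz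
    have := hg.sub_sub_mem (x := x + z) (y := x) (K := U) (by simpa using hEU hz)
    rw [hgx, sub_sub_sub_cancel_right] at this
    exact this
  have hcS : ∀ z t, c (z + t) - c z ∈ U → c (z + t) - c z ∈ P.rowStab U t := by
    intro z t hU
    refine ⟨hU, fun d hd hr => ?_⟩
    have h1 := hper hd (z + t)
    have h2 := hg (z + t + d) z
    have e : z + t + d - z = t + d := by abel
    rw [e, h1] at h2
    have e2 : t + d + (c (z + t) - c z) = g (z + t) + d - g z := by simp only [hc]; abel
    rw [e2]
    exact P.trans h2 hr
  -- if some stabilizer in `x + E` vanishes, then along `d ∈ E` the displacement changes by elements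
  -- of the independent subgroups belonging to `x + e + d` and `x + e - d`
  by_cases hex : ∃ e ∈ E, P.rowStab U (x + e) = ⊥
  · obtain ⟨e, he, hbot⟩ := hex
    have hEfix : ∀ d ∈ E, c d = 0 := by
      intro d hd
      by_cases hdU : d ∈ U
      · have := hcper 0 d hdU
        rwa [zero_add, hc0] at this
      have hshift : ∀ z ∈ E, c (x + e + z) = c z := by
        intro z hz
        have h1 := hcS z (x + e) (by
          have := U.sub_mem (hcxE _ (E.add_mem he hz)) (hcE z hz)
          have e1 : z + (x + e) = x + (e + z) := by abel
          rwa [e1])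
        rw [hbot, AddSubgroup.mem_bot, sub_eq_zero] at h1
        rw [← h1]; congr 1; abel
      have h1 := hcS 0 (x + e + d) (by
        have := hcxE _ (E.add_mem he hd)
        rwa [zero_add, hc0, sub_zero, add_assoc])
      rw [zero_add, hc0, sub_zero, hshift d hd] at h1
      have h2 := hcS d (x + e - d) (by
        have e1 : d + (x + e - d) = x + e := by abel
        rw [e1]
        exact U.sub_mem (hcxE _ he) (hcE d hd))
      have e1 : d + (x + e - d) = x + e + 0 := by abel
      rw [e1, hshift 0 E.zero_mem, hc0, zero_sub] at h2
      have h3 := AddSubgroup.neg_mem _ h2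
      rw [neg_neg] at h3
      refine hdisj (t := x + e - d) (t' := x + e + d) ?_ ?_ ?_ _ h3 h1
      · rw [add_sub_assoc]; exact hxU (E.sub_mem he hd)
      · have e1 : x + e + d - (x + e - d) = (2 : ℤ) • d := by rw [two_smul]; abel
        rw [e1]; exact E.zsmul_mem hd 2
      · have e1 : x + e + d - (x + e - d) = (2 : ℤ) • d := by rw [two_smul]; abel
        rw [e1]; exact fun h => hdU (two_mem U d h)
    exact hind.eq_of_fixed hp hH hE (by simpa using htopE) hg (x := 0)
      (fun y hy => sub_eq_zero.1 (hEfix y (by simpa using hy))) z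
  · push Not at hex
    have hne : ∀ t, t ∉ E → P.rowStab U t ≠ ⊥ := by
      intro t ht
      obtain ⟨m, m', hm, hmt⟩ := P.exists_unit_zsmul_sub_mem hp le_top htopE
        (AddSubgroup.mem_top x) hxE (AddSubgroup.mem_top t) ht
      have h1 : m' • t - x ∈ E := by
        have := E.zsmul_mem hmt m'
        rwa [smul_sub, (hm _).1] at this
      have := hex _ h1
      rwa [add_sub_cancel, rowStab_zsmul (fun y => (hm y).symm)] at this
    -- `g` maps `z` to a point with the same nontrivial stabilizer, hence in the same coset of `U`
    have hcU : ∀ z, c z ∈ U := by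
      intro z
      by_cases hz : z ∈ E
      · exact hcE z hz
      by_contra hzU
      have hzE : c z ∈ E := htE (AddSubgroup.mem_top z) _ (hg.rel_self h0 z)
      have hle : P.rowStab U z ≤ P.rowStab U (g z) := by
        rintro s ⟨hs, h⟩
        have hrel : ∀ d ∈ U, P.rel (g z + d) (z + d) := by
          intro d hd
          rw [← hper hd z]
          exact hg.rel_self h0 _
        refine ⟨hs, fun d hd hr => ?_⟩
        have h1 := h d hd (P.trans (P.symm (hrel d hd)) (P.trans hr (hg.rel_self h0 z)))
        have h2 := hrel _ (U.add_mem hd hs)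
        rw [← add_assoc, ← add_assoc] at h2
        exact P.trans h2 (P.trans h1 (P.symm (hg.rel_self h0 z)))
      refine hne z hz ((AddSubgroup.eq_bot_iff_forall _).2 fun s hs => ?_)
      exact hdisj hz hzE hzU s hs (hle hs)
    have hcS' : ∀ t z, c (z + t) - c z ∈ P.rowStab U t := fun t z =>
      hcS z t (U.sub_mem (hcU _) (hcU _))
    -- three directions in different cosets of `U`, up to a multiple: the third is `2 • (x + h)`
    obtain ⟨h, hhE, hhU⟩ : ∃ h ∈ E, h ∉ U := by
      by_contra! hle
      have h1 := AddSubgroup.card_le_of_le (show E ≤ U from hle)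
      rw [hEc] at h1
      have h2 : 0 < Nat.card U := Nat.card_pos
      have := hp.two_le
      nlinarith
    have h2E : (2 : ℤ) • h ∈ E := E.zsmul_mem hhE 2
    have h2U : (2 : ℤ) • h ∉ U := fun h' => hhU (two_mem U h h')
    have hS₃ : P.rowStab U (x + (x + (2 : ℤ) • h)) = P.rowStab U (x + h) := by
      rw [← rowStab_zsmul hτ (x + h)]
      congr 1
      simp only [two_smul]; abel
    obtain ⟨i, hi⟩ := exists_zsmul_sub_mem hp le_top htopE (AddSubgroup.mem_top _) hxE
      (AddSubgroup.mem_top z)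
    obtain ⟨j, hj⟩ := exists_zsmul_sub_mem hp hUE hEc h2E h2U hi
    have hz := eq_zero_of_three_directions (c := c) (t₁ := x) (t₂ := x + (2 : ℤ) • h)
      (F₁ := P.rowStab U x) (F₂ := P.rowStab U (x + (2 : ℤ) • h)) (F₃ := P.rowStab U (x + h))
      (hdisj hxE (by simpa using h2E) (by simpa using h2U))
      (hdisj hxE (by simpa using hhE) (by simpa using hhU))
      (fun s hs hs' => hdisj (hxU hhE) (by simpa [two_smul] using hhE)
        (by simpa [two_smul] using hhU) s hs' hs)
      (hcS' _) (hcS' _) (hS₃ ▸ hcS' _) hc0 hcx (i - j) j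
    have := hcper ((i - j) • x + j • (x + (2 : ℤ) • h)) _ hj
    rw [hz] at this
    have e : (i - j) • x + j • (x + (2 : ℤ) • h) + (z - i • x - j • (2 : ℤ) • h) = z := by
      rw [sub_smul, smul_add]; abel
    rw [e] at this
    exact sub_eq_zero.1 this

/-- If the thin radical has order `p`, either some basic set of size at most `p` consists of base
points, or all basic sets outside an `A`-subgroup of index `p` have at most `p²` elements and
consist of base points. -/
theorem exists_base_or_of_card_thinMod (hind : P.Indecomposable) :
    (∃ x, {y | P.rel y x}.ncard ≤ p ∧ P.IsBase x) ∨
    ∃ E : AddSubgroup H, Nat.card E = p ^ 3 ∧ P.Sat E ∧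
      ∀ x, x ∉ E → {y | P.rel y x}.ncard ≤ p ^ 2 ∧ P.IsBase x := by
  set L := P.thinMod ⊥ with hLdef
  have hLsat : P.Sat L := P.sat_thinMod P.sat_bot
  have hLtop : L ≠ ⊤ := by
    intro h
    rw [h, AddSubgroup.card_top, hH] at hO
    exact absurd (Nat.pow_right_injective hp.two_le (hO.trans (pow_one p).symm)) (by norm_num)
  obtain ⟨U, hU, hLU, hUc⟩ := P.exists_sat_card hp hH hLsat hLtop
  have hUtop : U ≠ ⊤ := by
    intro h
    rw [h, AddSubgroup.card_top, hH, hO, ← pow_two] at hUc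
    exact absurd (Nat.pow_right_injective hp.two_le hUc) (by norm_num)
  obtain ⟨E, hE, hUE, hEc⟩ := P.exists_sat_card hp hH hU hUtop
  have hEc3 : Nat.card E = p ^ 3 := by rw [hEc, hUc, hO]; ring
  have htopE : Nat.card (⊤ : AddSubgroup H) = p * Nat.card E := by
    rw [AddSubgroup.card_top, hH, hEc3]; ring
  have hEtop : E ≠ ⊤ := by
    intro h
    rw [h, AddSubgroup.card_top, hH] at hEc3
    exact absurd (Nat.pow_right_injective hp.two_le hEc3) (by norm_num)
  have htE := P.le_thinMod_of_card hp hH hE P.sat_top le_top htopE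
  have hLE := hLU.trans hUE
  have hLbot : L ≠ ⊥ := by
    intro h
    rw [h, AddSubgroup.card_bot] at hO
    exact hp.one_lt.ne hO
  obtain ⟨x, hxE, l, hl, hxl⟩ := hind E L hE hLsat hLE hEtop hLbot
  have hx := isSection_of_not_rel hp le_rfl hO hl hxl
  have hcards : ∀ t, P.IsSection L t → {y | P.rel y t}.ncard ≤ p ^ 2 := by
    intro t ht
    have := card_mul_le hLE (htE (AddSubgroup.mem_top t))
      (fun a b ha hb hab => ht.eq_of_rel le_rfl ha hb hab)
    rw [hEc3, hO, pow_succ] at this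
    exact Nat.le_of_mul_le_mul_right this hp.pos
  by_cases hcx : {y | P.rel y x}.ncard ≤ p
  · exact Or.inl (exists_base_of_card_le hp hH hO hind hU hE hLU hUE hUc hEc hxE hcx)
  by_cases hb : ∃ b ∈ E, b ∉ L ∧ P.IsSection L b
  · obtain ⟨b, hbE, hbL, hb⟩ := hb
    exact Or.inl (exists_base_of_isSection_mem hp hH hO hind hU hE hLU hUE hUc hEc hbE hbL hb)
  push Not at hb
  have hcx2 : {y | P.rel y x}.ncard = p ^ 2 := by
    obtain ⟨j, hj⟩ := P.card_class x
    have h1 := hcards x hx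
    rw [hj] at hcx h1 ⊢
    have h2 := (Nat.pow_le_pow_iff_right hp.one_lt).1 h1
    have h3 : 1 < j := by
      by_contra! h
      exact hcx ((Nat.pow_le_pow_right hp.pos h).trans (pow_one p).le)
    rw [le_antisymm h2 h3]
  -- the basic set of `x` meets all the cosets of `L` in `x + E`
  have hnearx : ∀ y, y - x ∈ E → P.near L y x := by
    have hsub : (fun q : H × H => q.1 + q.2 - x) '' ({y | P.rel y x} ×ˢ (L : Set H)) ⊆ E := by
      rintro _ ⟨⟨a, k⟩, ⟨ha, hk⟩, rfl⟩
      have h1 := htE (AddSubgroup.mem_top x) a ha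
      have e : a + k - x = a - x + k := by abel
      simp only [e]
      exact E.add_mem h1 (hLE hk)
    have hinj : Set.InjOn (fun q : H × H => q.1 + q.2 - x) ({y | P.rel y x} ×ˢ (L : Set H)) := by
      rintro ⟨a, k⟩ ⟨ha, hk⟩ ⟨a', k'⟩ ⟨ha', hk'⟩ h
      simp only [sub_left_inj] at h
      have h1 : a = a' := hx.eq_of_rel le_rfl ha ha' (by
        have : a - a' = k' - k := by rw [sub_eq_sub_iff_add_eq_add, h, add_comm]
        rw [this]; exact L.sub_mem hk' hk)
      subst h1
      simpa using h
    have heq := Set.eq_of_subset_of_ncard_le hsub (by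
      rw [hinj.ncard_image, Set.ncard_prod, hcx2]
      have e1 : (E : Set H).ncard = p ^ 3 := hEc3
      have e2 : (L : Set H).ncard = p := hO
      rw [e1, e2, pow_succ])
    intro y hy
    rw [← SetLike.mem_coe, ← heq] at hy
    obtain ⟨⟨a, k⟩, ⟨ha, hk⟩, e⟩ := hy
    simp only [sub_left_inj] at e
    refine ⟨-k, L.neg_mem hk, ?_⟩
    rw [← e, add_neg_cancel_right]
    exact ha
  have hmul : ∀ t, t ∉ E → ∃ m m' : ℤ, (∀ x : H, m' • m • x = x ∧ m • m' • x = x) ∧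
      ∀ y, y - t ∈ E → P.near L (m' • y) x := by
    intro t ht
    obtain ⟨m, m', hm, hmt⟩ := P.exists_unit_zsmul_sub_mem hp le_top htopE
      (AddSubgroup.mem_top x) hxE (AddSubgroup.mem_top t) ht
    refine ⟨m, m', hm, fun y hy => hnearx _ ?_⟩
    have := E.zsmul_mem (E.add_mem hy hmt) m'
    have e : y - t + (t - m • x) = y - m • x := by abel
    rwa [e, smul_sub, (hm _).1] at this
  have hsec : ∀ t, t ∉ E → P.IsSection L t := by
    intro t ht
    obtain ⟨m, m', hm, h⟩ := hmul t ht
    obtain ⟨k, hk, h1⟩ := h t (by simp)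
    have h2 := IsSection.zsmul le_rfl hm ((hx.of_rel le_rfl (P.symm h1)).add_of_thin le_rfl
      (AddSubgroup.neg_mem _ hk))
    rwa [add_neg_cancel_right, (hm t).2] at h2
  have hnear : ∀ t, t ∉ E → ∀ y, y - t ∈ E → P.near L y t := by
    intro t ht y hy
    obtain ⟨m, m', hm, h⟩ := hmul t ht
    have h1 := P.near_trans hLsat (h y hy) (P.near_symm hLsat (h t (by simp)))
    have h2 := P.near_zsmul L m h1
    rwa [(hm _).2, (hm _).2] at h2
  refine Or.inr ⟨E, hEc3, hE, fun t ht => ⟨hcards t (hsec t ht), ?_⟩⟩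
  refine isBase_of_card_sq hp hodd hH hO hind hU hE hLU hUE hUc hEc hsec
    (fun t ht => hcards t (hsec t ht)) hnear (fun w hw hwL k hk => ?_) ht
  by_contra h
  exact hb w hw hwL (isSection_of_not_rel hp le_rfl hO hk h)

end cases

/-- In an indecomposable `p`-S-ring over a group of order `p⁴`, there is a base point in a basic set
of size at most `p`, or all points outside an `A`-subgroup of index `p` are base points and lie in
basic sets of size at most `p²`. -/
theorem exists_base_or (hp : p.Prime) (hodd : Odd p) (hH : Nat.card H = p ^ 4)
    (hind : P.Indecomposable) :
    (∃ x, {y | P.rel y x}.ncard ≤ p ∧ P.IsBase x) ∨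
    ∃ E : AddSubgroup H, Nat.card E = p ^ 3 ∧ P.Sat E ∧
      ∀ x, x ∉ E → {y | P.rel y x}.ncard ≤ p ^ 2 ∧ P.IsBase x := by
  obtain ⟨i, hi, hO⟩ := card_subgroup hp hH (P.thinMod ⊥)
  have hcl0 : {y | P.rel y 0}.ncard ≤ p := by
    have : {y | P.rel y 0} = {0} := by
      ext y
      simp only [Set.mem_ofPred_eq, Set.mem_singleton_iff]
      exact ⟨P.eq_zero, fun h => h ▸ P.refl _⟩
    rw [this, Set.ncard_singleton]
    exact hp.one_lt.le
  interval_cases i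
  · rw [pow_zero, AddSubgroup.card_eq_one] at hO
    obtain ⟨y, -, hy0, hy⟩ := P.exists_mem_thinMod hp hH P.sat_bot P.sat_top (by
      rw [bot_lt_iff_ne_bot]
      intro h
      have h1 := AddSubgroup.card_top (G := H)
      rw [h, AddSubgroup.card_bot, hH] at h1
      exact absurd (Nat.one_lt_pow four_ne_zero hp.one_lt) (by omega))
    rw [hO] at hy
    exact absurd hy hy0
  · exact exists_base_or_of_card_thinMod hp hodd hH (by simpa using hO) hind
  · by_cases htop : P.thinMod (P.thinMod ⊥) = ⊤
    · exact Or.inl (exists_base_of_thinMod_eq_top hp hH hind hO htop)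
    · exact Or.inl (exists_base_of_thinMod_ne_top hp hH hind hO htop)
  · exact Or.inl ⟨0, hcl0, isBase_zero_of_le hp hH hind hO le_rfl⟩
  · refine Or.inl ⟨0, hcl0, fun g hg h0 _ z => ?_⟩
    have htop : P.thinMod ⊥ = ⊤ := AddSubgroup.eq_top_of_card_eq _ (by rw [hO, hH])
    have := hg.thin_le_periods (htop ▸ AddSubgroup.mem_top z) 0
    simpa [h0] using this

end PSchurPartition
end SchurRing

/-! ### The partition of an S-ring and Schur's theorem on multipliers -/

namespace SchurRing
namespace SRing

open scoped Classical in
theorem coeff_simpleQuantity {H : Type*} [Fintype H] (T : Set H) (x : H) :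
    (simpleQuantity T).coeff x = if x ∈ T then 1 else 0 := by
  rw [simpleQuantity, AddMonoidAlgebra.coeff_sum, Finsupp.finsetSum_apply]
  rw [Finset.sum_eq_single x]
  · split_ifs <;> simp
  · intro b _ hb
    split_ifs
    · simp [AddMonoidAlgebra.coeff_single, hb]
    · simp
  · simp

variable {H : Type*} [AddCommGroup H] [Fintype H] (A : SRing H)

/-- `x` and `y` lie in the same basic set. -/
def SameClass (x y : H) : Prop := ∃ T ∈ A.basicSets, x ∈ T ∧ y ∈ T

variable {A}

theorem SameClass.mem_iff {x y : H} (h : A.SameClass x y) {T : Set H} (hT : T ∈ A.basicSets) :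
    x ∈ T ↔ y ∈ T := by
  obtain ⟨S, hS, hx, hy⟩ := h
  constructor
  · intro hxT
    rwa [(A.isPartition.2 x).unique ⟨hT, hxT⟩ ⟨hS, hx⟩]
  · intro hyT
    rwa [(A.isPartition.2 y).unique ⟨hT, hyT⟩ ⟨hS, hy⟩]

theorem sameClass_refl (x : H) : A.SameClass x x := by
  obtain ⟨T, ⟨hT, hx⟩, -⟩ := A.isPartition.2 x
  exact ⟨T, hT, hx, hx⟩

theorem SameClass.symm {x y : H} (h : A.SameClass x y) : A.SameClass y x := by
  obtain ⟨T, hT, hx, hy⟩ := h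
  exact ⟨T, hT, hy, hx⟩

theorem SameClass.trans {x y z : H} (h : A.SameClass x y) (h' : A.SameClass y z) :
    A.SameClass x z := by
  obtain ⟨T, hT, hx, hy⟩ := h
  exact ⟨T, hT, hx, (h'.mem_iff hT).1 hy⟩

theorem setOf_sameClass {T : Set H} (hT : T ∈ A.basicSets) {x : H} (hx : x ∈ T) :
    {y | A.SameClass y x} = T := by
  ext y
  exact ⟨fun h => (h.mem_iff hT).2 hx, fun hy => ⟨T, hT, hy, hx⟩⟩

/-- The elements of an S-ring are constant on the basic sets. -/
theorem coeff_eq_of_mem {f : AddMonoidAlgebra ℚ H} (hf : f ∈ A.algebra) {x y : H}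
    (h : A.SameClass x y) : f.coeff x = f.coeff y := by
  classical
  have hf' : f ∈ Submodule.span ℚ (simpleQuantity '' A.basicSets) := by
    rw [← A.span_eq]; exact hf
  clear hf
  induction hf' using Submodule.span_induction with
  | mem f hf =>
    obtain ⟨T, hT, rfl⟩ := hf
    rw [coeff_simpleQuantity, coeff_simpleQuantity, h.mem_iff hT]
  | zero => simp
  | add a b _ _ iha ihb =>
    rw [AddMonoidAlgebra.coeff_add, Finsupp.add_apply, Finsupp.add_apply, iha, ihb]
  | smul c a _ iha =>
    rw [AddMonoidAlgebra.coeff_smul, Finsupp.smul_apply, Finsupp.smul_apply, iha]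

/-- A union of basic sets has its simple quantity in the S-ring. -/
theorem simpleQuantity_mem {S : Set H} (hS : ∀ x y, A.SameClass x y → x ∈ S → y ∈ S) :
    simpleQuantity S ∈ A.algebra := by
  classical
  have hfin : A.basicSets.Finite := Set.toFinite _
  have e : simpleQuantity S = ∑ T ∈ hfin.toFinset.filter (· ⊆ S), simpleQuantity T := by
    ext x
    rw [AddMonoidAlgebra.coeff_sum, Finsupp.finsetSum_apply, coeff_simpleQuantity]
    simp_rw [coeff_simpleQuantity]
    obtain ⟨T, ⟨hT, hxT⟩, huniq⟩ := A.isPartition.2 x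
    by_cases hx : x ∈ S
    · rw [if_pos hx, Finset.sum_eq_single T, if_pos hxT]
      · intro B hB hne
        rw [if_neg]
        intro hxB
        simp only [Finset.mem_filter, Set.Finite.mem_toFinset] at hB
        exact hne (huniq B ⟨hB.1, hxB⟩)
      · intro hn
        exfalso
        apply hn
        simp only [Finset.mem_filter, Set.Finite.mem_toFinset]
        exact ⟨hT, fun y hy => hS x y ⟨T, hT, hxT, hy⟩ hx⟩
    · rw [if_neg hx, Finset.sum_eq_zero]
      intro B hB
      rw [if_neg]
      intro hxB
      simp only [Finset.mem_filter] at hB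
      exact hx (hB.2 hxB)
  rw [e]
  refine Subalgebra.sum_mem _ fun T hT => ?_
  simp only [Finset.mem_filter, Set.Finite.mem_toFinset] at hT
  rw [← Subalgebra.mem_toSubmodule, A.span_eq]
  exact Submodule.subset_span ⟨T, hT.1, rfl⟩

theorem isSub_iff {K : AddSubgroup H} :
    A.IsSub K ↔ ∀ x y, A.SameClass x y → x ∈ K → y ∈ K := by
  classical
  constructor
  · intro h x y hxy hx
    have := coeff_eq_of_mem h hxy
    simp only [coeff_simpleQuantity, SetLike.mem_coe] at this
    by_contra hy
    rw [if_pos hx, if_neg hy] at this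
    exact one_ne_zero this
  · exact fun h => simpleQuantity_mem h

theorem coeff_mul_eq_sum {R : Type*} [Semiring R] (f g : AddMonoidAlgebra R H) (x : H) :
    (f * g).coeff x = ∑ u : H, f.coeff u * g.coeff (x - u) := by
  rw [AddMonoidAlgebra.coeff_mul_apply_left, Finsupp.sum_fintype _ _ (by simp)]
  exact Finset.sum_congr rfl fun u _ => by rw [neg_add_eq_sub]

/-- The structure constants of an S-ring are well defined. -/
theorem ncard_eq_of_sameClass {S S' : Set H} (hS : ∀ x y, A.SameClass x y → x ∈ S → y ∈ S)
    (hS' : ∀ x y, A.SameClass x y → x ∈ S' → y ∈ S') {x y : H} (h : A.SameClass x y) :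
    {u | u ∈ S ∧ x - u ∈ S'}.ncard = {u | u ∈ S ∧ y - u ∈ S'}.ncard := by
  classical
  have key : ∀ z, (simpleQuantity S * simpleQuantity S').coeff z
      = ({u | u ∈ S ∧ z - u ∈ S'}.ncard : ℚ) := by
    intro z
    rw [coeff_mul_eq_sum, Set.ncard_eq_toFinset_card']
    simp_rw [coeff_simpleQuantity, ite_zero_mul_ite_zero]
    simp
  have := coeff_eq_of_mem (A.algebra.mul_mem (simpleQuantity_mem hS) (simpleQuantity_mem hS')) h
  rw [key, key] at this
  exact_mod_cast this

/-- Functions constant on the basic sets, with values in any finite ring, are closed under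
convolution. -/
theorem coeff_mul_eq {R : Type*} [Semiring R] [Finite R] {f g : AddMonoidAlgebra R H}
    (hf : ∀ x y, A.SameClass x y → f.coeff x = f.coeff y)
    (hg : ∀ x y, A.SameClass x y → g.coeff x = g.coeff y) (x y : H) (h : A.SameClass x y) :
    (f * g).coeff x = (f * g).coeff y := by
  classical
  have := Fintype.ofFinite R
  have key : ∀ z, (f * g).coeff z
      = ∑ b : R × R, {u | u ∈ {v | f.coeff v = b.1} ∧ z - u ∈ {v | g.coeff v = b.2}}.ncard •
        (b.1 * b.2) := by
    intro z
    rw [coeff_mul_eq_sum]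
    rw [← Finset.sum_fiberwise (s := Finset.univ) (g := fun u => (f.coeff u, g.coeff (z - u)))]
    refine Finset.sum_congr rfl fun b _ => ?_
    rw [Finset.sum_congr rfl (g := fun _ => b.1 * b.2), Finset.sum_const]
    · congr 1
      rw [Set.ncard_eq_toFinset_card']
      congr 1
      ext u
      simp [Prod.ext_iff]
    · intro u hu
      simp only [Finset.mem_filter] at hu
      rw [← hu.2]
  rw [key, key]
  refine Finset.sum_congr rfl fun b _ => ?_
  congr 1
  refine ncard_eq_of_sameClass (fun x y h hx => ?_) (fun x y h hx => ?_) h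
  · rw [Set.mem_ofPred_eq] at hx ⊢; rw [← hf x y h, hx]
  · rw [Set.mem_ofPred_eq] at hx ⊢; rw [← hg x y h, hx]

/-- Schur's theorem on multipliers, for a prime multiplier: the power `T ^ q` of a basic set
agrees modulo `q` with the image of `T` under multiplication by `q`. -/
theorem exists_sameClass_nsmul_of_prime {q : ℕ} (hq : q.Prime)
    (hinj : Function.Injective fun x : H => q • x) {x y : H} (h : A.SameClass (q • x) y) :
    ∃ x', A.SameClass x x' ∧ y = q • x' := by
  classical
  have : Fact q.Prime := ⟨hq⟩
  have : CharP (AddMonoidAlgebra (ZMod q) H) q := charP_of_injective_algebraMap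
    (algebraMap (ZMod q) (AddMonoidAlgebra (ZMod q) H)).injective q
  obtain ⟨T, ⟨hT, hxT⟩, -⟩ := A.isPartition.2 x
  let f : AddMonoidAlgebra (ZMod q) H := ∑ t ∈ T.toFinset, AddMonoidAlgebra.single t 1
  have hfc : ∀ z, f.coeff z = if z ∈ T then 1 else 0 := by
    intro z
    simp [f, AddMonoidAlgebra.coeff_sum, Finsupp.finsetSum_apply, AddMonoidAlgebra.coeff_single,
      Finsupp.single_apply]
  have hpow : ∀ n : ℕ, ∀ x y, A.SameClass x y → (f ^ (n + 1)).coeff x = (f ^ (n + 1)).coeff y := by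
    intro n
    induction n with
    | zero =>
      intro x y h
      rw [zero_add, pow_one, hfc, hfc, h.mem_iff hT]
    | succ n ih =>
      intro x y h
      rw [pow_succ]
      refine coeff_mul_eq ih (fun x y h => ?_) x y h
      rw [hfc, hfc, h.mem_iff hT]
  have hfq : ∀ z, (f ^ q).coeff z = if z ∈ (fun t => q • t) '' T then 1 else 0 := by
    intro z
    have e : f ^ q = ∑ t ∈ T.toFinset, AddMonoidAlgebra.single (q • t) 1 := by
      simp only [f]
      rw [sum_pow_char]
      exact Finset.sum_congr rfl fun t _ => by rw [AddMonoidAlgebra.single_pow, one_pow]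
    rw [e, AddMonoidAlgebra.coeff_sum, Finsupp.finsetSum_apply]
    simp only [AddMonoidAlgebra.coeff_single, Finsupp.single_apply]
    split_ifs with hz
    · obtain ⟨t, ht, rfl⟩ := hz
      rw [Finset.sum_eq_single t]
      · simp
      · intro b _ hb
        rw [if_neg]
        exact fun h => hb (hinj h)
      · intro hn
        exact absurd (by simpa using ht) hn
    · refine Finset.sum_eq_zero fun t ht => ?_
      rw [if_neg]
      rintro rfl
      exact hz ⟨t, by simpa using ht, rfl⟩
  have hq1 : q - 1 + 1 = q := Nat.sub_add_cancel hq.one_lt.le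
  have h1 := hpow (q - 1) _ _ h
  rw [hq1, hfq, hfq, if_pos ⟨x, hxT, rfl⟩] at h1
  have h2 : y ∈ (fun t => q • t) '' T := by
    by_contra hn
    rw [if_neg hn] at h1
    exact one_ne_zero h1
  obtain ⟨x', hx', rfl⟩ := h2
  exact ⟨x', ⟨T, hT, hxT, hx'⟩, rfl⟩

theorem nsmul_injective {H : Type*} [AddCommGroup H] {p : ℕ} (hp : p.Prime)
    (hexp : ∀ x : H, p • x = 0) {m : ℕ} (hm : ¬ p ∣ m) : Function.Injective fun x : H => m • x := by
  intro x y hxy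
  have hz : m • (x - y) = 0 := by
    rw [smul_sub, sub_eq_zero]; exact hxy
  have h1 := addOrderOf_dvd_of_nsmul_eq_zero hz
  have h2 := addOrderOf_dvd_of_nsmul_eq_zero (hexp (x - y))
  rcases (Nat.dvd_prime hp).1 h2 with h | h
  · exact sub_eq_zero.1 (AddMonoid.addOrderOf_eq_one_iff.1 h)
  · rw [h] at h1
    exact absurd h1 hm

section
variable {p : ℕ} (hp : p.Prime) (hexp : ∀ x : H, p • x = 0)
include hp hexp

theorem exists_sameClass_nsmul {m : ℕ} (hm : ¬ p ∣ m) {x y : H} (h : A.SameClass (m • x) y) :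
    ∃ x', A.SameClass x x' ∧ y = m • x' := by
  induction m using Nat.recOnMul generalizing x y with
  | zero => exact absurd (dvd_zero p) hm
  | one => exact ⟨y, by simpa using h, by simp⟩
  | prime q hq => exact exists_sameClass_nsmul_of_prime hq (nsmul_injective hp hexp hm) h
  | mul a b iha ihb =>
    have ha : ¬ p ∣ a := fun h => hm (h.mul_right b)
    have hb : ¬ p ∣ b := fun h => hm (h.mul_left a)
    rw [mul_smul] at h
    obtain ⟨w, hw, rfl⟩ := iha ha h
    obtain ⟨v, hv, rfl⟩ := ihb hb hw
    exact ⟨v, hv, by rw [mul_smul]⟩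

/-- Schur's theorem on multipliers: the multiples of basic sets are basic sets. -/
theorem SameClass.zsmul (m : ℤ) {x y : H} (h : A.SameClass x y) :
    A.SameClass (m • x) (m • y) := by
  have hp0 : (0 : ℤ) < p := by exact_mod_cast hp.pos
  -- reduce to a natural number
  have hmod : ∀ z : H, m • z = (m % p).toNat • z := by
    intro z
    rw [← natCast_zsmul, Int.toNat_of_nonneg (Int.emod_nonneg m hp0.ne'), Int.emod_def, sub_smul,
      mul_comm, mul_smul, natCast_zsmul, hexp, smul_zero, sub_zero]
  rw [hmod, hmod]
  set n := (m % p).toNat with hn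
  have hnp : n < p := by
    have := Int.emod_lt_of_pos m hp0
    omega
  by_cases hn0 : n = 0
  · rw [hn0, zero_smul, zero_smul]; exact sameClass_refl 0
  -- `n'` is an inverse of `n` modulo `p`
  have hndvd : ¬ p ∣ n := Nat.not_dvd_of_pos_of_lt (Nat.pos_of_ne_zero hn0) hnp
  obtain ⟨n', -, hn'⟩ := Nat.exists_mul_mod_eq_one_of_coprime
    ((Nat.Prime.coprime_iff_not_dvd hp).2 hndvd).symm hp.one_lt
  have hinv : ∀ z : H, (n * n') • z = z := by
    intro z
    rw [← Nat.mod_add_div (n * n') p, hn', add_smul, one_smul, mul_comm, mul_smul, hexp,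
      smul_zero, add_zero]
  have hn'dvd : ¬ p ∣ n' := by
    intro hd
    have := Nat.mod_eq_zero_of_dvd (hd.mul_left n)
    omega
  have h' : A.SameClass (n' • n • x) y := by
    rw [smul_smul, mul_comm, hinv]; exact h
  obtain ⟨w, hw, rfl⟩ := exists_sameClass_nsmul hp hexp hn'dvd h'
  rw [smul_smul n, hinv]
  exact hw

end

/-- The partition into basic sets of a `p`-S-ring over a group of exponent `p`. -/
def toPartition (A : SRing H) {p : ℕ} (hp : p.Prime) (hexp : ∀ x : H, p • x = 0)
    (hA : A.IsPSRing p) : PSchurPartition p H where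
  rel := A.SameClass
  refl := sameClass_refl
  symm := SameClass.symm
  trans := SameClass.trans
  eq_zero := by
    intro x h
    simpa using (h.mem_iff A.zero_mem).2 (Set.mem_singleton 0)
  zsmul m _ _ h := h.zsmul hp hexp m
  count := ncard_eq_of_sameClass
  card_class := by
    intro x
    obtain ⟨T, ⟨hT, hx⟩, -⟩ := A.isPartition.2 x
    rw [setOf_sameClass hT hx]
    exact hA.2 T hT
  nsmul_eq_zero := hexp

section
variable {p : ℕ} (hp : p.Prime) (hexp : ∀ x : H, p • x = 0) (hA : A.IsPSRing p)

theorem toPartition_indecomposable (hind : A.Indecomposable) :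
    (A.toPartition hp hexp hA).Indecomposable := by
  intro E F hE hF hFE hEtop hFbot
  by_contra! hcon
  refine hind ⟨E, F, ⟨isSub_iff.2 hE, isSub_iff.2 hF, hFE, inferInstance, ?_⟩, hEtop, hFbot⟩
  intro T hT hTE f hf
  have key : ∀ f ∈ F, ∀ x ∈ T, x + f ∈ T := fun f hf x hx =>
    ((hcon x (hTE hx) f hf).mem_iff hT).2 hx
  have himg : (fun s => s + f) '' T = T := by
    ext x
    constructor
    · rintro ⟨s, hs, rfl⟩
      exact key f hf s hs
    · intro hx
      exact ⟨x + -f, key _ (F.neg_mem hf) x hx, by simp⟩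
  refine ⟨?_, himg⟩
  simpa only [add_comm f] using himg

theorem mem_aut_iff {g : Equiv.Perm H} :
    g ∈ A.aut ↔ (A.toPartition hp hexp hA).IsAut g := by
  have hadj : ∀ (T : Set H) (x y : H), CayleyAdj T x y ↔ y - x ∈ T := by
    intro T x y
    constructor
    · rintro ⟨s, hs, rfl⟩; simpa using hs
    · intro h; exact ⟨y - x, h, by simp⟩
  simp only [aut, Subgroup.mem_iInf]
  constructor
  · intro h x y
    obtain ⟨T, ⟨hT, hx⟩, -⟩ := A.isPartition.2 (x - y)
    refine ⟨T, hT, ?_, hx⟩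
    have := (h T hT y x)
    rw [hadj, hadj] at this
    exact this.2 hx
  · intro h T hT x y
    rw [hadj, hadj]
    exact (h y x).mem_iff hT

end

end SRing
end SchurRing

/-! ### The automorphism group -/

namespace SchurRing

theorem card_mul_relIndex {Γ : Type*} [Group Γ] {K L : Subgroup Γ} (h : K ≤ L) :
    Nat.card K * K.relIndex L = Nat.card L := by
  have := Subgroup.relIndex_mul_relIndex ⊥ K L bot_le h
  rwa [Subgroup.relIndex_bot_left, Subgroup.relIndex_bot_left] at this

theorem exists_index_eq_pow {Γ : Type*} [Group Γ] [Finite Γ] {p : ℕ} (hp : p.Prime)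
    (hΓ : IsPGroup p Γ) (M : Subgroup Γ) : ∃ i, M.index = p ^ i := by
  have : Fact p.Prime := ⟨hp⟩
  obtain ⟨n, hn⟩ := IsPGroup.iff_card.1 hΓ
  obtain ⟨i, -, hi⟩ := (Nat.dvd_prime_pow hp).1 (hn ▸ M.index_dvd_card)
  exact ⟨i, hi⟩

theorem normal_of_index_le {Γ : Type*} [Group Γ] [Finite Γ] {p : ℕ} (hp : p.Prime)
    (hΓ : IsPGroup p Γ) {M : Subgroup Γ} (hM : M.index ≤ p) : M.Normal := by
  have : Fact p.Prime := ⟨hp⟩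
  obtain ⟨i, hi⟩ := exists_index_eq_pow hp hΓ M
  have hi1 : i ≤ 1 := (Nat.pow_le_pow_iff_right hp.one_lt).1 (by rwa [← hi, pow_one])
  interval_cases i
  · have htop : M = ⊤ := Subgroup.index_eq_one.1 (by simpa using hi)
    rw [htop]
    infer_instance
  · rw [pow_one] at hi
    refine Subgroup.normal_of_index_eq_minFac_card ?_
    obtain ⟨n, hn⟩ := IsPGroup.iff_card.1 hΓ
    have hd : p ∣ p ^ n := by rw [← hn, ← hi]; exact M.index_dvd_card
    have hn0 : n ≠ 0 := by
      rintro rfl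
      exact hp.one_lt.ne' (Nat.dvd_one.1 (by simpa using hd))
    rw [hi, hn, Nat.pow_minFac hn0, hp.minFac_eq]

/-- An abelian subgroup `N` of index at most `p²` in a finite `p`-group is normal, or there is an
element outside `N` which centralizes a subgroup of index at most `p` in `N`. -/
theorem normal_or_exists_commute {Γ : Type*} [Group Γ] [Finite Γ] {p : ℕ} (hp : p.Prime)
    (hΓ : IsPGroup p Γ) (N : Subgroup Γ) (hN : ∀ a ∈ N, ∀ b ∈ N, a * b = b * a)
    (hidx : N.index ≤ p ^ 2) :
    N.Normal ∨ ∃ h ∉ N, ∃ D ≤ N, Nat.card N ≤ p * Nat.card D ∧ ∀ d ∈ D, d * h = h * d := by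
  have : Fact p.Prime := ⟨hp⟩
  rw [or_iff_not_imp_left]
  intro hnot
  set M := Subgroup.normalizer (N : Set Γ) with hM
  have hMtop : M ≠ ⊤ := fun h => hnot (Subgroup.normalizer_eq_top_iff.1 h)
  have hNM : N ≤ M := Subgroup.le_normalizer
  have : Group.IsNilpotent Γ := hΓ.isNilpotent
  have hNM' : N < M := Group.normalizerCondition_of_isNilpotent N (lt_top_iff_ne_top.2 fun h =>
    hMtop (top_le_iff.1 (h ▸ hNM)))
  have hmul := Subgroup.relIndex_mul_index hNM
  obtain ⟨i, hi⟩ := exists_index_eq_pow hp hΓ N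
  obtain ⟨j, hj⟩ := exists_index_eq_pow hp hΓ M
  have hj0 : j ≠ 0 := by
    rintro rfl
    exact hMtop (Subgroup.index_eq_one.1 (by simpa using hj))
  have hrel1 : N.relIndex M ≠ 1 := fun h => hNM'.not_ge (Subgroup.relIndex_eq_one.1 h)
  have hi2 : i ≤ 2 := (Nat.pow_le_pow_iff_right hp.one_lt).1 (hi ▸ hidx)
  have hji : j < i := by
    by_contra! h
    have h1 : N.index ≤ M.index := by rw [hi, hj]; exact Nat.pow_le_pow_right hp.pos h
    have h2 : 0 < M.index := Nat.pos_of_ne_zero Subgroup.index_ne_zero_of_finite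
    have h3 : N.relIndex M ≠ 0 := by
      intro h0
      rw [h0, zero_mul] at hmul
      exact Subgroup.index_ne_zero_of_finite hmul.symm
    have h4 : 2 ≤ N.relIndex M := by omega
    nlinarith
  have hj1 : M.index = p := by
    have : j = 1 := by omega
    rw [hj, this, pow_one]
  have hrel : N.relIndex M = p := by
    have : i = 2 := by omega
    rw [hj1, hi, this, pow_two] at hmul
    exact Nat.eq_of_mul_eq_mul_right hp.pos hmul
  have hMn := normal_of_index_le hp hΓ hj1.le
  obtain ⟨g, hg⟩ : ∃ g, g ∉ M := by
    by_contra! h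
    exact hMtop ((Subgroup.eq_top_iff' M).2 h)
  set N' := N.map (MulAut.conj g).toMonoidHom with hN'
  have hcard : Nat.card N' = Nat.card N :=
    Nat.card_congr (N.equivMapOfInjective _ (MulAut.conj g).injective).toEquiv.symm
  have hN'M : N' ≤ M := by
    rintro _ ⟨n, hn, rfl⟩
    exact hMn.conj_mem n (hNM hn) g
  have hnle : ¬ N' ≤ N := by
    intro hle
    have heq : N' = N := Subgroup.eq_of_le_of_card_ge hle hcard.ge
    apply hg
    rw [hM, Subgroup.mem_normalizer_iff]
    intro h
    constructor
    · intro hh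
      have : g * h * g⁻¹ ∈ N' := ⟨h, hh, rfl⟩
      rwa [heq] at this
    · intro hh
      have : g * h * g⁻¹ ∈ N' := by rw [heq]; exact hh
      obtain ⟨n, hn, e⟩ := this
      have e' : g * n * g⁻¹ = g * h * g⁻¹ := e
      have : n = h := by simpa using e'
      rwa [← this]
  obtain ⟨h, hh', hhN⟩ := SetLike.not_le_iff_exists.1 hnle
  have hN'rel : N'.relIndex M = p := by
    have h1 := card_mul_relIndex hN'M
    have h2 := card_mul_relIndex hNM
    rw [hcard, ← h2, hrel] at h1
    exact Nat.eq_of_mul_eq_mul_left Nat.card_pos h1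
  refine ⟨h, hhN, N ⊓ N', inf_le_left, ?_, ?_⟩
  · have h1 : (N ⊓ N').relIndex N ≤ p := by
      rw [Subgroup.inf_relIndex_left, ← hN'rel]
      refine Subgroup.relIndex_le_of_le_right hNM ?_
      rw [hN'rel]; exact hp.ne_zero
    rw [← card_mul_relIndex (inf_le_left : N ⊓ N' ≤ N), mul_comm]
    exact Nat.mul_le_mul_right _ h1
  · rintro d ⟨-, hd⟩
    obtain ⟨a, ha, rfl⟩ := hd
    obtain ⟨b, hb, rfl⟩ := hh'
    rw [← map_mul, ← map_mul, hN a ha b hb]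

theorem card_rightTranslations (H : Type*) [AddGroup H] :
    Nat.card (rightTranslations H) = Nat.card H := by
  refine (Nat.card_congr (Equiv.ofInjective (fun h : H => Equiv.addRight h) ?_)).symm
  intro a b h
  simpa using congrArg (fun g : Equiv.Perm H => g 0) h

namespace PSchurPartition

variable {p : ℕ} {H : Type*} [AddCommGroup H] (P : PSchurPartition p H)

/-- The automorphism group of the S-ring. -/
def autGroup : Subgroup (Equiv.Perm H) where
  carrier := {g | P.IsAut g}
  mul_mem' := fun {a b} ha hb x y => P.trans (ha (b x) (b y)) (hb x y)
  one_mem' := fun x y => P.refl _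
  inv_mem' := by
    intro a ha x y
    have := ha (a⁻¹ x) (a⁻¹ y)
    rw [← Equiv.Perm.mul_apply, ← Equiv.Perm.mul_apply, mul_inv_cancel] at this
    exact P.symm this

theorem addRight_mem_autGroup (a : H) : Equiv.addRight a ∈ P.autGroup := by
  intro x y
  simpa using P.refl (x - y)

theorem rightTranslations_le_autGroup : rightTranslations H ≤ P.autGroup := by
  rintro _ ⟨a, rfl⟩
  exact P.addRight_mem_autGroup a

/-- If there is a base point, then the automorphism group is determined by its orbits on pairs:
an automorphism is determined by its values at `0` and at the base point. -/
theorem eq_autGroup_of_twoEquivalent {x : H} (hx : P.IsBase x) {X : Subgroup (Equiv.Perm H)}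
    (hX : TwoEquivalent X P.autGroup) : X = P.autGroup := by
  have horb : ∀ w : H × H, MulAction.orbit X w = MulAction.orbit P.autGroup w := by
    intro w
    have h1 : MulAction.orbit X w ∈ pairOrbits P.autGroup := by
      rw [← hX]; exact ⟨w, rfl⟩
    obtain ⟨v, hv⟩ := h1
    have h2 : w ∈ MulAction.orbit P.autGroup v := by
      simp only at hv
      rw [hv]; exact MulAction.mem_orbit_self w
    rw [← hv]
    exact (MulAction.orbit_eq_iff.2 h2).symm
  have hXle : X ≤ P.autGroup := by
    intro g hg a b
    have h1 : (g a, g b) ∈ MulAction.orbit X (a, b) := ⟨⟨g, hg⟩, rfl⟩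
    rw [horb] at h1
    obtain ⟨⟨g', hg'⟩, e⟩ := h1
    have e1 : g' a = g a := congrArg Prod.fst e
    have e2 : g' b = g b := congrArg Prod.snd e
    rw [← e1, ← e2]
    exact hg' a b
  refine le_antisymm hXle fun g hg => ?_
  have h1 : (g 0, g x) ∈ MulAction.orbit P.autGroup ((0 : H), x) := ⟨⟨g, hg⟩, rfl⟩
  rw [← horb] at h1
  obtain ⟨⟨g', hg'⟩, e⟩ := h1
  have e1 : g' 0 = g 0 := congrArg Prod.fst e
  have e2 : g' x = g x := congrArg Prod.snd e
  have hgg : g'⁻¹ * g = 1 := by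
    ext z
    exact hx _ (P.autGroup.mul_mem (P.autGroup.inv_mem (hXle hg')) hg)
      (by simp [← e1]) (by simp [← e2]) z
  rwa [inv_mul_eq_one.1 hgg] at hg'

section
variable {P} [Finite H]

theorem pow_sub_mem {K M : AddSubgroup H} (hM : M ≤ P.thinMod K) {g : Equiv.Perm H}
    (hg : P.IsAut g) (h : ∀ z, g z - z ∈ M) (hK : K ≤ M) (z : H) : (g ^ p) z - z ∈ K := by
  have key : ∀ n : ℕ, (g ^ n) z - z - n • (g z - z) ∈ K := by
    intro n
    induction n with
    | zero => simp
    | succ n ih =>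
      have h1 : (g ^ n) z - z ∈ M := by
        have := M.add_mem (hK ih) (M.nsmul_mem (h z) n)
        simpa using this
      have h2 := K.add_mem (hg.sub_sub_mem (hM h1)) ih
      have e : (g ^ (n + 1)) z = g ((g ^ n) z) := by rw [pow_succ', Equiv.Perm.mul_apply]
      rw [e, succ_nsmul]
      convert h2 using 1
      abel
  have := key p
  rwa [P.nsmul_eq_zero, sub_zero] at this

/-- The automorphism group of a `p`-S-ring is a `p`-group: it acts trivially on the factors of a
chain of `A`-subgroups with factors of order `p`. -/
theorem isPGroup_autGroup (hp : p.Prime) {n : ℕ} (hH : Nat.card H = p ^ n) :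
    IsPGroup p P.autGroup := by
  have key : ∀ (g : Equiv.Perm H), P.IsAut g → ∀ (d : ℕ) (K : AddSubgroup H), P.Sat K →
      Nat.card K * p ^ d = p ^ n → ∃ k : ℕ, ∀ z, (g ^ p ^ k) z - z ∈ K := by
    intro g hg d
    induction d with
    | zero =>
      intro K _ hc
      have : K = ⊤ := AddSubgroup.eq_top_of_card_eq K (by rw [hH, ← hc]; simp)
      exact ⟨0, fun z => this ▸ AddSubgroup.mem_top _⟩
    | succ d ih =>
      intro K hK hc
      have hne : K ≠ ⊤ := by
        rintro rfl
        rw [AddSubgroup.card_top, hH] at hc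
        have h1 : 1 < p ^ (d + 1) := Nat.one_lt_pow (by omega) hp.one_lt
        have h2 : 0 < p ^ n := Nat.pow_pos hp.pos
        nlinarith
      obtain ⟨M, hM, hKM, hMc⟩ := P.exists_sat_card hp hH hK hne
      obtain ⟨k, hk⟩ := ih M hM (by rw [hMc, ← hc]; ring)
      refine ⟨k + 1, fun z => ?_⟩
      rw [pow_succ, pow_mul]
      exact pow_sub_mem (P.le_thinMod_of_card hp hH hK hM hKM hMc)
        (P.autGroup.pow_mem (show g ∈ P.autGroup from hg) _) hk hKM z
  rw [isPGroup_iff_pow_pow_eq_one]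
  rintro ⟨g, hg⟩
  obtain ⟨k, hk⟩ := key g hg n ⊥ P.sat_bot (by simp)
  refine ⟨k, ?_⟩
  ext z
  have := hk z
  rw [AddSubgroup.mem_bot, sub_eq_zero] at this
  simpa using this

/-- An automorphism `g` is determined by `g 0` and the element `g x - g 0` of the basic set of a base
point `x`. -/
theorem card_autGroup_le {x : H} (hx : P.IsBase x) :
    Nat.card P.autGroup ≤ Nat.card H * {y | P.rel y x}.ncard := by
  have hinj : Function.Injective (fun g : P.autGroup =>
      ((g.1 0, ⟨g.1 x - g.1 0, by simpa using g.2 x 0⟩) : H × {y | P.rel y x})) := by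
    rintro ⟨g, hg⟩ ⟨g', hg'⟩ h
    simp only [Prod.mk.injEq, Subtype.mk.injEq] at h
    obtain ⟨h0, h1⟩ := h
    rw [h0, sub_left_inj] at h1
    have := hx _ (P.autGroup.mul_mem (P.autGroup.inv_mem hg') hg) (by simp [h0]) (by simp [h1])
    ext z
    have hz := this z
    rw [Equiv.Perm.mul_apply, Equiv.Perm.inv_eq_iff_eq] at hz
    simpa using hz
  have := Nat.card_le_card_of_injective _ hinj
  rw [Nat.card_prod] at this
  exact this

/-- An automorphism which commutes with the translations by `p ^ 3` elements is a translation. After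
subtraction of its value at `0` it fixes these elements, which form `E` or contain a base point. -/
theorem eq_add_of_card_periods (hp : p.Prime) (hH : Nat.card H = p ^ 4) (hind : P.Indecomposable)
    {E : AddSubgroup H} (hEc : Nat.card E = p ^ 3) (hE : P.Sat E)
    (hbase : ∀ x, x ∉ E → P.IsBase x) {g : H → H} (hg : P.IsAut g)
    (hper : p ^ 3 ≤ Nat.card (periods g)) (z : H) : g z = z + g 0 := by
  have hn := hg.sub_const
  have hfix : ∀ a ∈ periods g, g a - g 0 = a := by
    intro a ha
    have := ha 0
    rw [zero_add] at this
    rw [this]; abel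
  have key : ∀ z, g z - g 0 = z := by
    by_cases hle : periods g ≤ E
    · have heq : periods g = E := AddSubgroup.eq_of_le_of_card_ge hle (by rw [hEc]; exact hper)
      exact hind.eq_of_fixed hp hH hE (by rw [hH, hEc]; ring) hn (x := 0)
        (fun y hy => hfix y (heq ▸ by simpa using hy))
    · obtain ⟨a, ha, haE⟩ := SetLike.not_le_iff_exists.1 hle
      exact hbase a haE _ hn (by simp) (hfix a ha)
  rw [← sub_eq_iff_eq_add]
  exact key z

/-- A base point with a basic set of size at most `m` bounds the index of the translations. -/
theorem index_rightTranslations_le {x : H} (hx : P.IsBase x) {m : ℕ}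
    (hm : {y | P.rel y x}.ncard ≤ m) : ((rightTranslations H).subgroupOf P.autGroup).index ≤ m := by
  have h1 := (card_autGroup_le hx).trans (Nat.mul_le_mul_left _ hm)
  rw [← ((rightTranslations H).subgroupOf P.autGroup).card_mul_index,
    Nat.card_congr (Subgroup.subgroupOfEquivOfLe P.rightTranslations_le_autGroup).toEquiv,
    card_rightTranslations] at h1
  exact Nat.le_of_mul_le_mul_left h1 Nat.card_pos

/-- The translations form a normal subgroup of the automorphism group. If all points outside an
`A`-subgroup of index `p` are base points, then the index of the translations may be `p ^ 2`; a
failure of normality would then give an automorphism which is not a translation and commutes with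
`p ^ 3` translations. -/
theorem normal_rightTranslations (hp : p.Prime) (hp_odd : Odd p) (hH : Nat.card H = p ^ 4)
    (hind : P.Indecomposable) : ((rightTranslations H).subgroupOf P.autGroup).Normal := by
  set N := (rightTranslations H).subgroupOf P.autGroup with hN
  have hΓ := isPGroup_autGroup (P := P) hp hH
  have hNcard : Nat.card N = p ^ 4 := by
    rw [hN, Nat.card_congr (Subgroup.subgroupOfEquivOfLe P.rightTranslations_le_autGroup).toEquiv,
      card_rightTranslations, hH]
  rcases exists_base_or hp hp_odd hH hind with ⟨y, hy, hb⟩ | ⟨E, hEc, hE, hb⟩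
  · exact normal_of_index_le hp hΓ (index_rightTranslations_le hb hy)
  obtain ⟨x, hx⟩ : ∃ x, x ∉ E := by
    by_contra! h
    rw [(AddSubgroup.eq_top_iff' E).2 h, AddSubgroup.card_top, hH] at hEc
    exact absurd (Nat.pow_right_injective hp.two_le hEc) (by norm_num)
  have hcomm : ∀ a ∈ N, ∀ b ∈ N, a * b = b * a := by
    rintro ⟨_, _⟩ ⟨a, rfl⟩ ⟨_, _⟩ ⟨b, rfl⟩
    ext z
    simp [add_right_comm]
  rcases normal_or_exists_commute hp hΓ N hcomm
    (index_rightTranslations_le (hb x hx).2 (hb x hx).1) with h | ⟨h, hh, D, hD, hDc, hDh⟩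
  · exact h
  exfalso
  have hval : ∀ d ∈ N, ∀ z, d.1 z = z + d.1 0 := by
    rintro ⟨_, _⟩ ⟨a, rfl⟩ z
    simp
  have hmem : ∀ d ∈ D, d.1 0 ∈ periods h.1 := by
    intro d hd z
    have h1 : (h * d).1 z = (d * h).1 z := by rw [hDh d hd]
    have h2 : h.1 (d.1 z) = d.1 (h.1 z) := h1
    rw [hval d (hD hd) z, hval d (hD hd) (h.1 z)] at h2
    exact h2
  have hDp : Nat.card D ≤ Nat.card (periods h.1) := by
    refine Nat.card_le_card_of_injective (fun d : D => ⟨d.1.1 0, hmem d.1 d.2⟩) ?_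
    intro d d' hdd
    have h0 : d.1.1 0 = d'.1.1 0 := congrArg Subtype.val hdd
    ext z
    rw [hval _ (hD d.2), hval _ (hD d'.2), h0]
  have hper : p ^ 3 ≤ Nat.card (periods h.1) := by
    refine le_trans ?_ hDp
    rw [hNcard, pow_succ'] at hDc
    exact Nat.le_of_mul_le_mul_left hDc hp.pos
  have := eq_add_of_card_periods hp hH hind hEc hE (fun y hy => (hb y hy).2) h.2 hper
  exact hh ⟨h.1 0, Equiv.ext fun z => (this z).symm⟩

/-- There is a base point whose basic set has at most `p ^ 2` elements. -/
theorem exists_base (hp : p.Prime) (hp_odd : Odd p) (hH : Nat.card H = p ^ 4)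
    (hind : P.Indecomposable) : ∃ x, {y | P.rel y x}.ncard ≤ p ^ 2 ∧ P.IsBase x := by
  rcases exists_base_or hp hp_odd hH hind with ⟨x, hx, hb⟩ | ⟨E, hE, -, hb⟩
  · exact ⟨x, hx.trans (Nat.le_self_pow two_ne_zero p), hb⟩
  · obtain ⟨x, hx⟩ : ∃ x, x ∉ E := by
      by_contra! h
      rw [(AddSubgroup.eq_top_iff' E).2 h, AddSubgroup.card_top, hH] at hE
      exact absurd (Nat.pow_right_injective hp.two_le hE) (by norm_num)
    exact ⟨x, hb x hx⟩

end

end PSchurPartition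

end SchurRing

theorem theorem4 (p : ℕ) (hp : p.Prime) (hp_odd : Odd p)
    {H : Type*} [AddCommGroup H] [Fintype H] (hH : Nonempty (H ≃+ (Fin 4 → ZMod p)))
    (A : SchurRing.SRing H) (hA : A.IsPSRing p) (hA_ind : A.Indecomposable) :
    (A.Schurian → A.TwoEquivMinimal) ∧
      SchurRing.rightTranslations H ≤ A.aut ∧
      ((SchurRing.rightTranslations H).subgroupOf A.aut).Normal ∧
      Nat.card A.aut ≤ p ^ 6 := by
  obtain ⟨φ⟩ := hH
  have : NeZero p := ⟨hp.ne_zero⟩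
  have hcard : Nat.card H = p ^ 4 := by
    rw [Nat.card_congr φ.toEquiv]
    simp
  have hexp : ∀ x : H, p • x = 0 := by
    intro x
    apply φ.injective
    rw [map_nsmul, map_zero]
    ext i
    simp
  let P := A.toPartition hp hexp hA
  have hind : P.Indecomposable := SchurRing.SRing.toPartition_indecomposable hp hexp hA hA_ind
  have haut : A.aut = P.autGroup := by
    ext g
    exact SchurRing.SRing.mem_aut_iff hp hexp hA
  obtain ⟨x, hx, hxbase⟩ := P.exists_base hp hp_odd hcard hind
  rw [haut]
  refine ⟨fun _ => ?_, P.rightTranslations_le_autGroup,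
    P.normal_rightTranslations hp hp_odd hcard hind, ?_⟩
  · rw [SchurRing.SRing.TwoEquivMinimal, haut]
    ext X
    refine ⟨fun hX => P.eq_autGroup_of_twoEquivalent hxbase hX.2, ?_⟩
    rintro rfl
    exact ⟨P.rightTranslations_le_autGroup, rfl⟩
  · calc Nat.card P.autGroup ≤ Nat.card H * {y | P.rel y x}.ncard := P.card_autGroup_le hxbase
      _ ≤ p ^ 4 * p ^ 2 := by rw [hcard]; exact Nat.mul_le_mul_left _ hx
      _ = p ^ 6 := by ring
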